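/- Let $A$ be a non-empty finite alphabet with an irreflexive symmetric relation $I$ (independence), and let $\mathcal M=\mathcal M(A,I)$ be the trace monoid, i.e. the quotient of the free monoid $A^*$ by the congruence generated by the pairs $(ab,ba)$, $(a,b)\in I$. For $u,v\in\mathcal M$, let $|u|$ be the length of any word representing $u$, and write $u\le v$ if $v=u\cdot w$ for some $w\in\mathcal M$. A clique is a set $c\subseteq A$ (possibly empty) of pairwise independent letters; it is identified with the product of its letters in $\mathcal M$. For non-empty cliques write $c\to c'$ if for every $a\in c'$ there is $b\in c$ with $(b,a)\notin I$. Every trace $u$ has a unique Cartier–Foata decomposition $u=c_1\cdots c_n$ with non-empty cliques $c_1\to\cdots\to c_n$. Let $\partial\mathcal M$ be the set of infinite sequences $c_1\to c_2\to\cdots$ of non-empty cliques, and let $\overline{\mathcal M}=\mathcal M\cup\partial\mathcal M$. For $\xi\in\overline{\mathcal M}$ let $\tau_n(\xi)\in\mathcal M$ be the product of the first $n$ cliques of $\xi$ (of all of them, if there are fewer than $n$), and put $\zeta\le\xi$ if $\tau_n(\zeta)\le\tau_n(\xi)$ for all $n\ge0$. For $u\in\mathcal M$ let $\Uparrow u=\{\xi\in\overline{\mathcal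 M}: u\le\xi\}$. Equip $\overline{\mathcal M}$ with the topology generated by all subsets of $\mathcal M$, all cylinders $\Uparrow u$ and their complements, and with its Borel $\sigma$-algebra. Let $\mu_{\mathcal M}(X)=\sum_{c\text{ clique}}(-1)^{|c|}X^{|c|}$. Then $\mu_{\mathcal M}$ has a unique complex root $p_0$ of smallest modulus (the principal root), and $p_0$ is a positive real number. There is a unique probability measure $\nu_{p_0}$ on $\overline{\mathcal M}$ such that $\nu_{p_0}(\Uparrow u)=p_0^{|u|}$ for all $u\in\mathcal M$ (the uniform measure), and $\nu_{p_0}(\partial\mathcal M)=1$. Let $\nu_{\mathcal M_k}$ be the uniform distribution on the finite set $\mathcal M_k=\{x\in\mathcal M:|x|=k\}$, seen as a probability measure on $\overline{\mathcal M}$. Then $\nu_{\mathcal M_k}$ converges weakly to $\nu_{p_0}$ as $k\to\infty$. -/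

import Mathlib

open Filter MeasureTheory Polynomial
open scoped Topology

namespace TraceMonoid

/-- The defining relations `a b = b a`, for `a`, `b` independent. An independence relation
(irreflexive and symmetric) on the alphabet `A` is a simple graph on `A`. -/
def rel {A : Type*} (I : SimpleGraph A) (x y : FreeMonoid A) : Prop :=
  ∃ a b : A, I.Adj a b ∧ x = FreeMonoid.of a * FreeMonoid.of b ∧
    y = FreeMonoid.of b * FreeMonoid.of a

/-- The trace monoid `M(A, I)`. Left divisibility `u ≤ v` of traces is `u ∣ v`, that is,
`∃ w, v = u * w`. -/
abbrev Trace {A : Type*} (I : SimpleGraph A) : Type _ := PresentedMonoid (rel I)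

/-- The generator of the trace monoid attached to a letter. -/
def gen {A : Type*} (I : SimpleGraph A) (a : A) : Trace I := PresentedMonoid.of (rel I) a

theorem gen_commute {A : Type*} (I : SimpleGraph A) {a b : A} (h : I.Adj a b) :
    Commute (gen I a) (gen I b) :=
  PresentedMonoid.mk_eq_mk_of_rel ⟨a, b, h, rfl, rfl⟩

/-- The length, as a monoid homomorphism. -/
def lengthHom {A : Type*} (I : SimpleGraph A) : Trace I →* Multiplicative ℕ :=
  PresentedMonoid.lift (fun _ : A => Multiplicative.ofAdd 1) (by
    rintro x y ⟨a, b, -, rfl, rfl⟩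
    simp)

/-- The length `|u|` of a trace: the length of any word representing it. -/
def length {A : Type*} (I : SimpleGraph A) (u : Trace I) : ℕ :=
  Multiplicative.toAdd (lengthHom I u)

/-- Non-empty cliques of the graph `(A, I)`. -/
abbrev NonemptyClique {A : Type*} (I : SimpleGraph A) : Type _ :=
  {c : Finset A // I.IsClique (c : Set A) ∧ c.Nonempty}

/-- The trace `a₁ ⋯ a_j` attached to a clique `{a₁, …, a_j}`, in any order. -/
def cliqueTrace {A : Type*} (I : SimpleGraph A) (c : NonemptyClique I) : Trace I :=
  c.1.noncommProd (gen I) (fun _ ha _ hb hab => gen_commute I (c.2.1 ha hb hab))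

/-- The Cartier-Foata relation `c → c'`: every letter of `c'` is dependent on some letter
of `c`. -/
def Admissible {A : Type*} (I : SimpleGraph A) (c c' : NonemptyClique I) : Prop :=
  ∀ a ∈ c'.1, ∃ b ∈ c.1, ¬ I.Adj b a

/-- The product of a list of cliques. -/
def listTrace {A : Type*} (I : SimpleGraph A) (l : List (NonemptyClique I)) : Trace I :=
  (l.map (cliqueTrace I)).prod

/-- `l` is a Cartier-Foata decomposition of `u`. -/
def IsCartierFoata {A : Type*} (I : SimpleGraph A) (u : Trace I)
    (l : List (NonemptyClique I)) : Prop :=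
  l.IsChain (Admissible I) ∧ listTrace I l = u

/-- The Cartier-Foata decomposition of a trace (every trace has exactly one). -/
noncomputable def cartierFoata {A : Type*} (I : SimpleGraph A) (u : Trace I) :
    List (NonemptyClique I) :=
  Classical.epsilon (IsCartierFoata I u)

/-- Infinite traces: infinite paths `c₁ → c₂ → ⋯` of non-empty cliques (`c_{i+1}` is the value
at `i : ℕ`). -/
abbrev InfTrace {A : Type*} (I : SimpleGraph A) : Type _ :=
  {ξ : ℕ → NonemptyClique I // ∀ i, Admissible I (ξ i) (ξ (i + 1))}

/-- Finite and infinite traces together. -/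
inductive Completion {A : Type*} (I : SimpleGraph A) : Type _
  | fin (u : Trace I) : Completion I
  | inf (ξ : InfTrace I) : Completion I

/-- The `n`-topping: the product of the first `n` cliques. -/
noncomputable def topping {A : Type*} (I : SimpleGraph A) (n : ℕ) : Completion I → Trace I
  | .fin u => listTrace I ((cartierFoata I u).take n)
  | .inf ξ => listTrace I (List.ofFn (fun i : Fin n => ξ.1 i))

/-- The order on finite and infinite traces, through the left divisibility of toppings. -/
instance {A : Type*} (I : SimpleGraph A) : LE (Completion I) where
  le ζ ξ := ∀ n : ℕ, topping I n ζ ∣ topping I n ξ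

/-- The elementary cylinder of base `u`, among finite and infinite traces. -/
def cylinder {A : Type*} (I : SimpleGraph A) (u : Trace I) : Set (Completion I) :=
  {ξ | Completion.fin u ≤ ξ}

/-- The boundary at infinity, as a subset of the completion. -/
def boundary {A : Type*} (I : SimpleGraph A) : Set (Completion I) :=
  Set.range Completion.inf

/-- The topology generated by all sets of finite traces and by the elementary cylinders and
their complements. -/
instance {A : Type*} (I : SimpleGraph A) : TopologicalSpace (Completion I) :=
  TopologicalSpace.generateFrom
    ({U | ∃ s : Set (Trace I), U = Completion.fin '' s} ∪
      {U | ∃ u : Trace I, U = cylinder I u} ∪ {U | ∃ u : Trace I, U = (cylinder I u)ᶜ})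

instance {A : Type*} (I : SimpleGraph A) : MeasurableSpace (Completion I) := borel _

instance {A : Type*} (I : SimpleGraph A) : BorelSpace (Completion I) := ⟨rfl⟩

/-- Finite traces carry the discrete sigma-algebra. -/
instance {A : Type*} (I : SimpleGraph A) : MeasurableSpace (Trace I) := ⊤

instance {A : Type*} (I : SimpleGraph A) : DiscreteMeasurableSpace (Trace I) :=
  ⟨fun _ => trivial⟩

/-- The set `M_k` of traces of length `k`. -/
def ofLength {A : Type*} (I : SimpleGraph A) (k : ℕ) : Set (Trace I) :=
  {u | length I u = k}

theorem length_mk {A : Type*} (I : SimpleGraph A) (w : FreeMonoid A) :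
    length I (PresentedMonoid.mk (rel I) w) = w.length := by
  induction w using FreeMonoid.inductionOn' with
  | one => simp [length]
  | of_mul a w ih =>
    have h : lengthHom I (PresentedMonoid.mk (rel I) (FreeMonoid.of a)) =
        Multiplicative.ofAdd 1 := PresentedMonoid.lift_of _ _
    simp only [length] at ih
    rw [length, map_mul, map_mul, toAdd_mul, ih, h]
    simp

theorem ofLength_finite {A : Type*} [Finite A] (I : SimpleGraph A) (k : ℕ) :
    (ofLength I k).Finite := by
  refine ((List.finite_length_eq A k).image
    (fun w => PresentedMonoid.mk (rel I) (FreeMonoid.ofList w))).subset ?_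
  intro u hu
  obtain ⟨w, rfl⟩ := PresentedMonoid.surjective_mk (rels := rel I) u
  exact ⟨FreeMonoid.toList w, (length_mk I w).symm.trans hu, rfl⟩

theorem ofLength_nonempty {A : Type*} [Nonempty A] (I : SimpleGraph A) (k : ℕ) :
    (ofLength I k).Nonempty := by
  obtain ⟨a⟩ := ‹Nonempty A›
  refine ⟨PresentedMonoid.mk (rel I) (FreeMonoid.ofList (List.replicate k a)), ?_⟩
  exact (length_mk I _).trans (List.length_replicate (n := k) (a := a))

/-- The uniform distribution on the traces of length `k`, on the trace monoid. -/
noncomputable def uniformFin {A : Type*} [Finite A] [Nonempty A] (I : SimpleGraph A) (k : ℕ) :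
    ProbabilityMeasure (Trace I) :=
  ⟨ProbabilityTheory.uniformOn (ofLength I k),
    ProbabilityTheory.isProbabilityMeasure_uniformOn (ofLength_finite I k)
      (ofLength_nonempty I k)⟩

/-- The uniform distribution on the traces of length `k`, as a probability measure on the
space of finite and infinite traces. -/
noncomputable def uniformOfLength {A : Type*} [Finite A] [Nonempty A] (I : SimpleGraph A)
    (k : ℕ) : ProbabilityMeasure (Completion I) :=
  (uniformFin I k).map (f := Completion.fin) Measurable.of_discrete.aemeasurable

open Classical in
/-- The Möbius polynomial: the sum of `(-1)^|c| X^|c|` over all cliques `c`, including the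
empty one. -/
noncomputable def moebius {A : Type*} [Fintype A] (I : SimpleGraph A) : ℤ[X] :=
  ∑ c ∈ Finset.univ.filter (fun c : Finset A => I.IsClique (c : Set A)),
    (-1) ^ c.card * X ^ c.card

/-- `p` is the principal root: the unique complex root of smallest modulus of the Möbius
polynomial. -/
def IsPrincipalRoot {A : Type*} [Fintype A] (I : SimpleGraph A) (p : ℂ) : Prop :=
  aeval p (moebius I) = 0 ∧ ∀ z : ℂ, aeval z (moebius I) = 0 → z ≠ p → ‖p‖ < ‖z‖

/-- `ν` is a sub-uniform measure of parameter `p`: the cylinder of base `u` has mass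
`p ^ |u|`, for every finite trace `u`. -/
def IsSubUniform {A : Type*} (I : SimpleGraph A) (p : ℝ)
    (ν : ProbabilityMeasure (Completion I)) : Prop :=
  ∀ u : Trace I, (ν (cylinder I u) : ℝ) = p ^ length I u

end TraceMonoid

/-! Let λ_k be the number of traces of length k. Left cancellation identifies the multiples of u in
`ofLength I k` with the traces of length k - |u|, so the uniform distribution gives the cylinder of
u the mass λ_{k-|u|} / λ_k. The theorem therefore rests on λ_k / λ_{k+1} → p₀, followed by a
compactness argument.

Combinatorics. A trace is represented by its heap: letters fall one by one and each stops just above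
the highest letter it depends on. The rows of the heap are the Cartier–Foata cliques. A clique
divides v exactly when it lies in the bottom row, so inclusion–exclusion gives (∑ λ_k X^k) · μ = 1.

Analysis. For letter sets W ⊆ V the series μ_W / μ_V has non-negative coefficients. Adding a letter
a to V replaces P = μ_V by N = P - X L = P (1 - X f), where f = L / P and L is the polynomial of the
letters of V independent of a. The equality case of the triangle inequality for z f(z) = 1 carries a
positive principal root from P to N (`IsPositivePrincipalRoot.exists_sub`). If p is the principal
root of μ, of multiplicity d + 1, then λ_k p^k / (d+k choose d) has a non-zero limit, and the ratios
converge (`IsPositivePrincipalRoot.tendsto_div`).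

Topology. The completion is a closed subset of a Cantor space (`isClosedEmbedding_code`), hence its
probability measures form a compact space. Cylinders are clopen, so every limit point gives the
cylinder of u the mass p^|u|; cylinder masses determine a measure (`eq_of_cylinder_eq`), so there is
a single limit point, which is the limit. It ignores each finite trace, an isolated point whose mass
is eventually zero. -/

namespace TraceMonoid

open scoped Classical

/-! ### Heaps, Cartier–Foata normal form and cancellation -/

section Heaps

variable {A : Type*} (I : SimpleGraph A)

/-- The rows from which on the letter `a` is independent of all letters of the heap `s`. -/
def freeRows (a : A) (s : ℕ → Finset A) : Set ℕ :=
  {i | ∀ j, i ≤ j → ∀ b ∈ s j, I.Adj b a}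

/-- The row on which the letter `a` lands when it is dropped on the heap `s`. -/
noncomputable def level (a : A) (s : ℕ → Finset A) : ℕ := sInf (freeRows I a s)

/-- Drop the letter `a` on the heap `s`. -/
noncomputable def push (a : A) (s : ℕ → Finset A) (j : ℕ) : Finset A :=
  if j = level I a s then insert a (s j) else s j

theorem mem_push {a b : A} {s : ℕ → Finset A} {j : ℕ} :
    b ∈ push I a s j ↔ b ∈ s j ∨ (b = a ∧ j = level I a s) := by
  unfold push
  split_ifs with h <;> simp [h, or_comm]

/-- Independent letters do not block each other, so the order in which they fall is irrelevant; this
makes `pushHom` well defined. -/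
theorem level_push {a b : A} (h : I.Adj a b) (s : ℕ → Finset A) :
    level I a (push I b s) = level I a s := by
  have : freeRows I a (push I b s) = freeRows I a s := by
    ext i
    simp only [freeRows, Set.mem_ofPred_eq, mem_push]
    constructor
    · intro H j hj c hc
      exact H j hj c (Or.inl hc)
    · rintro H j hj c (hc | ⟨rfl, -⟩)
      · exact H j hj c hc
      · exact h.symm
  rw [level, level, this]

theorem push_comm {a b : A} (h : I.Adj a b) (s : ℕ → Finset A) :
    push I a (push I b s) = push I b (push I a s) := by
  funext j
  ext c
  simp only [mem_push, level_push I h, level_push I h.symm]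
  tauto

/-- The action of traces on heaps, from the right. -/
noncomputable def pushHom : Trace I →* (Function.End (ℕ → Finset A))ᵐᵒᵖ :=
  PresentedMonoid.lift
    (fun a => (MulOpposite.op (push I a) : (Function.End (ℕ → Finset A))ᵐᵒᵖ)) (by
    rintro x y ⟨a, b, h, rfl, rfl⟩
    simp only [map_mul, FreeMonoid.lift_eval_of]
    refine MulOpposite.unop_injective ?_
    funext s
    exact push_comm I h.symm s)

/-- The rows of the heap of a trace: its Cartier-Foata cliques, followed by empty sets. -/
noncomputable def layers (u : Trace I) : ℕ → Finset A :=
  (pushHom I u).unop (fun _ => ∅)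

theorem layers_one : layers I 1 = fun _ => ∅ := by
  simp only [layers, map_one, MulOpposite.unop_one]
  rfl

theorem layers_mul_gen (u : Trace I) (a : A) :
    layers I (u * gen I a) = push I a (layers I u) := by
  simp only [layers, map_mul, MulOpposite.unop_mul]
  rfl

variable {I} in
@[elab_as_elim]
theorem induction_mul_gen {P : Trace I → Prop} (u : Trace I) (one : P 1)
    (mul_gen : ∀ u a, P u → P (u * gen I a)) : P u := by
  have h : u ∈ Submonoid.closure (Set.range (PresentedMonoid.of (rel I))) := by
    rw [PresentedMonoid.closure_range_of]; trivial
  induction h using Submonoid.closure_induction_right with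
  | one => exact one
  | mul_right x hx y hy ih =>
    obtain ⟨a, rfl⟩ := hy
    exact mul_gen x a ih

@[simp] theorem length_one : length I 1 = 0 := by simp [length]

@[simp] theorem length_mul (u v : Trace I) : length I (u * v) = length I u + length I v := by
  simp [length]

@[simp] theorem length_gen (a : A) : length I (gen I a) = 1 := by
  simp [length, lengthHom, gen]

/-- The conditions on the rows of the heap of a finite or infinite trace. -/
structure IsHeap (s : ℕ → Finset A) : Prop where
  clique : ∀ j, I.IsClique (s j : Set A)
  supported : ∀ j, ∀ a ∈ s (j + 1), ∃ b ∈ s j, ¬ I.Adj b a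

/-- The first `n` rows. -/
def trunc (n : ℕ) (s : ℕ → Finset A) (j : ℕ) : Finset A := if j < n then s j else ∅

theorem level_eq {a : A} {s : ℕ → Finset A} {i : ℕ} (h : i ∈ freeRows I a s)
    (h' : ∀ k, i = k + 1 → ∃ b ∈ s k, ¬ I.Adj b a) : level I a s = i := by
  refine le_antisymm (Nat.sInf_le h) (le_csInf ⟨i, h⟩ fun k hk => ?_)
  by_contra! hlt
  obtain ⟨b, hb, hba⟩ := h' (i - 1) (by omega)
  exact hba (hk (i - 1) (by omega) b hb)

theorem level_le {a : A} {s : ℕ → Finset A} {n : ℕ} (h : ∀ j, n ≤ j → s j = ∅) :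
    level I a s ≤ n :=
  Nat.sInf_le fun j hj b hb => by simp [h j hj] at hb

/-- Eventual emptiness is essential: otherwise `freeRows` could be empty and `sInf` would return the
default value 0. -/
theorem level_mem {a : A} {s : ℕ → Finset A} {n : ℕ} (h : ∀ j, n ≤ j → s j = ∅) :
    level I a s ∈ freeRows I a s :=
  Nat.sInf_mem (s := freeRows I a s) ⟨n, fun j hj b hb => by simp [h j hj] at hb⟩

theorem exists_of_level_eq_succ {a : A} {s : ℕ → Finset A} {n k : ℕ} (h : ∀ j, n ≤ j → s j = ∅)
    (hk : level I a s = k + 1) : ∃ b ∈ s k, ¬ I.Adj b a := by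
  by_contra! H
  have hm := level_mem I (a := a) h
  rw [hk] at hm
  have : level I a s ≤ k := Nat.sInf_le fun j hj b hb => by
    rcases hj.eq_or_lt with rfl | hj
    · exact H b hb
    · exact hm j hj b hb
  omega

theorem layers_eq_empty (u : Trace I) : ∀ j, length I u ≤ j → layers I u j = ∅ := by
  induction u using induction_mul_gen with
  | one => intro j _; simp [layers_one]
  | mul_gen u a ih =>
    intro j hj
    have h1 := level_le I (a := a) ih
    simp only [length_mul, length_gen] at hj
    rw [layers_mul_gen, push, if_neg (by omega), ih j (by omega)]

theorem isHeap_push {a : A} {s : ℕ → Finset A} {n : ℕ} (h : ∀ j, n ≤ j → s j = ∅)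
    (hs : IsHeap I s) : IsHeap I (push I a s) := by
  have hm := level_mem I (a := a) h
  constructor
  · intro j b hb c hc hbc
    simp only [SetLike.mem_coe, mem_push] at hb hc
    rcases hb with hb | ⟨rfl, rfl⟩ <;> rcases hc with hc | ⟨rfl, hj⟩
    · exact hs.clique j hb hc hbc
    · exact hm j hj.ge b hb
    · exact (hm _ le_rfl c hc).symm
    · exact absurd rfl hbc
  · intro j b hb
    rcases (mem_push I).1 hb with hb | ⟨rfl, hj⟩
    · obtain ⟨c, hc, hcb⟩ := hs.supported j b hb
      exact ⟨c, (mem_push I).2 (Or.inl hc), hcb⟩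
    · obtain ⟨c, hc, hcb⟩ := exists_of_level_eq_succ I h hj.symm
      exact ⟨c, (mem_push I).2 (Or.inl hc), hcb⟩

theorem isHeap_layers (u : Trace I) : IsHeap I (layers I u) := by
  induction u using induction_mul_gen with
  | one => rw [layers_one]; constructor <;> simp
  | mul_gen u a ih =>
    rw [layers_mul_gen]
    exact isHeap_push I (layers_eq_empty I u) ih

theorem pairwise_commute {c : Finset A} (h : I.IsClique (c : Set A)) :
    (c : Set A).Pairwise (Function.onFun Commute (gen I)) :=
  fun _ ha _ hb hab => gen_commute I (h ha hb hab)

/-- The product of the letters of a clique (and `1` for other sets of letters). -/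
noncomputable def cliqueProd (c : Finset A) : Trace I :=
  if h : I.IsClique (c : Set A) then
    c.noncommProd (gen I) (pairwise_commute I h) else 1

@[simp] theorem cliqueProd_empty : cliqueProd I ∅ = 1 := by simp [cliqueProd]

theorem cliqueTrace_eq (c : NonemptyClique I) : cliqueTrace I c = cliqueProd I c.1 := by
  rw [cliqueProd, dif_pos c.2.1, cliqueTrace]

theorem cliqueProd_insert {a : A} {c : Finset A} (h : I.IsClique (insert a c : Finset A))
    (ha : a ∉ c) : cliqueProd I (insert a c) = cliqueProd I c * gen I a := by
  have hc : I.IsClique (c : Set A) := h.subset (by simp)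
  rw [cliqueProd, cliqueProd, dif_pos h, dif_pos hc, Finset.noncommProd_insert_of_notMem' _ _ _ _ ha]

theorem cliqueProd_commute {a : A} {c : Finset A} (h : ∀ b ∈ c, I.Adj b a) :
    Commute (cliqueProd I c) (gen I a) := by
  unfold cliqueProd
  split_ifs with hc
  · exact (Finset.noncommProd_commute _ _ _ _ fun b hb => (gen_commute I (h b hb)).symm).symm
  · exact Commute.one_left _

/-- The product of the first `n` rows. -/
noncomputable def topProd (s : ℕ → Finset A) (n : ℕ) : Trace I :=
  ((List.range n).map fun j => cliqueProd I (s j)).prod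

@[simp] theorem topProd_zero (s : ℕ → Finset A) : topProd I s 0 = 1 := by simp [topProd]

theorem topProd_succ (s : ℕ → Finset A) (n : ℕ) :
    topProd I s (n + 1) = topProd I s n * cliqueProd I (s n) := by
  simp [topProd, List.range_succ]

theorem topProd_congr {s t : ℕ → Finset A} {n : ℕ} (h : ∀ j < n, s j = t j) :
    topProd I s n = topProd I t n := by
  rw [topProd, topProd]
  congr 1
  refine List.map_congr_left fun j hj => ?_
  rw [h j (List.mem_range.1 hj)]

theorem topProd_dvd (s : ℕ → Finset A) {m n : ℕ} (h : m ≤ n) :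
    topProd I s m ∣ topProd I s n := by
  induction n, h using Nat.le_induction with
  | base => exact dvd_rfl
  | succ n _ ih => rw [topProd_succ]; exact ih.mul_right _

theorem topProd_push_of_le {a : A} {s : ℕ → Finset A} {n : ℕ} (hn : n ≤ level I a s) :
    topProd I (push I a s) n = topProd I s n :=
  topProd_congr I fun j hj => by rw [push, if_neg (by omega)]

/-- The dropped letter enters the product at its landing row and commutes with all rows above it, so
it can be moved to the right end. -/
theorem topProd_push_of_lt {a : A} {s : ℕ → Finset A} {N n : ℕ} (hs : IsHeap I s)
    (h : ∀ j, N ≤ j → s j = ∅) (hn : level I a s < n) :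
    topProd I (push I a s) n = topProd I s n * gen I a := by
  have hm := level_mem I (a := a) h
  induction n, hn using Nat.le_induction with
  | base =>
    rw [Nat.succ_eq_add_one, topProd_succ, topProd_succ, topProd_push_of_le I le_rfl, mul_assoc]
    congr 1
    have hp : push I a s (level I a s) = insert a (s (level I a s)) := by simp [push]
    rw [hp]
    refine cliqueProd_insert I ?_ fun ha => (hm _ le_rfl a ha).ne rfl
    rw [← hp]
    exact (isHeap_push I h hs).clique _
  | succ n hn ih =>
    rw [topProd_succ, topProd_succ, ih, push, if_neg (by omega), mul_assoc, mul_assoc]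
    congr 1
    exact (cliqueProd_commute I (hm n (by omega))).symm

theorem topProd_layers (u : Trace I) :
    ∀ n, (∀ j, n ≤ j → layers I u j = ∅) → topProd I (layers I u) n = u := by
  induction u using induction_mul_gen with
  | one =>
    rintro n -
    rw [layers_one]
    induction n with
    | zero => simp
    | succ n ih => rw [topProd_succ, ih, cliqueProd_empty, mul_one]
  | mul_gen u a ih =>
    intro n hn
    rw [layers_mul_gen] at hn ⊢
    have hlt : level I a (layers I u) < n := by
      by_contra! hle
      simpa [push] using hn _ hle
    rw [topProd_push_of_lt I (isHeap_layers I u) (layers_eq_empty I u) hlt, ih]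
    intro j hj
    have := hn j hj
    rwa [push, if_neg (by omega)] at this

theorem topProd_layers_length (u : Trace I) {n : ℕ} (h : length I u ≤ n) :
    topProd I (layers I u) n = u :=
  topProd_layers I u n fun j hj => layers_eq_empty I u j (h.trans hj)

theorem layers_injective : Function.Injective (layers I) := by
  intro u v h
  rw [← topProd_layers_length I u (le_max_left _ (length I v)), h,
    topProd_layers_length I v (le_max_right _ _)]

/-- The letters of `d`, dropped one at a time, all stop on row `n`: they are blocked by row `n - 1`
because the heap is supported, and not by each other because `d` is part of a clique. -/
theorem layers_topProd_mul_cliqueProd {s : ℕ → Finset A} (hs : IsHeap I s) {n : ℕ}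
    (h : layers I (topProd I s n) = trunc n s) (d : Finset A) :
    d ⊆ s n → layers I (topProd I s n * cliqueProd I d) =
      fun j => if j < n then s j else if j = n then d else ∅ := by
  induction d using Finset.induction_on with
  | empty =>
    intro _
    rw [cliqueProd_empty, mul_one, h]
    funext j
    simp [trunc]
  | insert a d ha ih =>
    intro hd
    have had : a ∈ s n := hd (Finset.mem_insert_self _ _)
    have hds : d ⊆ s n := (Finset.subset_insert _ _).trans hd
    have hcl : I.IsClique ((insert a d : Finset A) : Set A) :=
      (hs.clique n).subset (Finset.coe_subset.2 hd)
    rw [cliqueProd_insert I hcl ha, ← mul_assoc, layers_mul_gen, ih hds]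
    have hl : level I a (fun j => if j < n then s j else if j = n then d else ∅) = n := by
      apply level_eq
      · intro j hj b hb
        simp only [not_lt.2 hj, if_false] at hb
        split_ifs at hb with hjn
        · exact hs.clique n (hds hb) had (by rintro rfl; exact ha hb)
        · simp at hb
      · rintro k rfl
        simpa using hs.supported k a had
    funext j
    rw [push, hl]
    grind

theorem layers_topProd {s : ℕ → Finset A} (hs : IsHeap I s) (n : ℕ) :
    layers I (topProd I s n) = trunc n s := by
  induction n with
  | zero => rw [topProd_zero, layers_one]; funext j; simp [trunc]
  | succ n ih =>
    rw [topProd_succ, layers_topProd_mul_cliqueProd I hs ih _ subset_rfl]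
    funext j
    simp only [trunc]
    grind

theorem layers_cliqueProd {c : Finset A} (hc : I.IsClique (c : Set A)) :
    layers I (cliqueProd I c) 0 = c := by
  have hs : IsHeap I (trunc 1 fun _ => c) := by
    constructor
    · intro j
      simp only [trunc]
      split_ifs
      · exact hc
      · simp
    · intro j a ha
      simp [trunc] at ha
  have := layers_topProd I hs 1
  rw [topProd_succ, topProd_zero, one_mul] at this
  simpa [trunc] using congrFun this 0

/-- A further letter either lands above the first `n` rows and leaves their product unchanged, or
multiplies it on the right. -/
theorem topProd_layers_dvd {u v : Trace I} (h : u ∣ v) (n : ℕ) :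
    topProd I (layers I u) n ∣ topProd I (layers I v) n := by
  obtain ⟨w, rfl⟩ := h
  induction w using induction_mul_gen with
  | one => simp
  | mul_gen w a ih =>
    rw [← mul_assoc, layers_mul_gen]
    rcases le_or_gt n (level I a (layers I (u * w))) with hn | hn
    · rwa [topProd_push_of_le I hn]
    · rw [topProd_push_of_lt I (isHeap_layers I _) (layers_eq_empty I _) hn]
      exact ih.mul_right _

theorem layers_zero_subset {u v : Trace I} (h : u ∣ v) : layers I u 0 ⊆ layers I v 0 := by
  obtain ⟨w, rfl⟩ := h
  induction w using induction_mul_gen with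
  | one => simp
  | mul_gen w a ih =>
    rw [← mul_assoc, layers_mul_gen]
    exact fun b hb => (mem_push I).2 (Or.inl (ih hb))

theorem cliqueProd_dvd_of_subset {c d : Finset A} (hd : I.IsClique (d : Set A)) (h : c ⊆ d) :
    cliqueProd I c ∣ cliqueProd I d := by
  have key : ∀ e : Finset A, I.IsClique ((e ∪ c : Finset A) : Set A) →
      cliqueProd I c ∣ cliqueProd I (e ∪ c) := by
    intro e
    induction e using Finset.induction_on with
    | empty => simp
    | insert a e _ ih =>
      intro he
      rw [Finset.insert_union] at he ⊢
      have ih := ih (he.subset (Finset.coe_subset.2 (Finset.subset_insert _ _)))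
      by_cases ha : a ∈ e ∪ c
      · rwa [Finset.insert_eq_self.2 ha]
      · rw [cliqueProd_insert I he ha]
        exact ih.mul_right _
  rw [← Finset.union_eq_left.2 h] at hd ⊢
  exact key d hd

/-- Right multiplication can only enlarge the bottom row; conversely, a subset of the bottom row
divides that row, which divides `v`. -/
theorem cliqueProd_dvd_iff {c : Finset A} (hc : I.IsClique (c : Set A)) {v : Trace I} :
    cliqueProd I c ∣ v ↔ c ⊆ layers I v 0 := by
  constructor
  · intro h
    have := layers_zero_subset I h
    rwa [layers_cliqueProd I hc] at this
  · intro h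
    refine (cliqueProd_dvd_of_subset I ((isHeap_layers I v).clique 0) h).trans ?_
    have := topProd_dvd I (layers I v) (Nat.le_add_left 1 (length I v))
    rwa [topProd_layers_length I v (Nat.le_add_right _ _), topProd_succ, topProd_zero,
      one_mul] at this

theorem IsHeap.eq_empty {s : ℕ → Finset A} (hs : IsHeap I s) {m n : ℕ} (h : m ≤ n)
    (hm : s m = ∅) : s n = ∅ := by
  induction n, h using Nat.le_induction with
  | base => exact hm
  | succ n _ ih =>
    rw [Finset.eq_empty_iff_forall_notMem]
    intro a ha
    obtain ⟨b, hb, -⟩ := hs.supported n a ha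
    simp [ih] at hb

theorem layers_zero_eq_empty_iff {u : Trace I} : layers I u 0 = ∅ ↔ u = 1 := by
  constructor
  · intro h
    have := topProd_layers I u 0 fun j hj => (isHeap_layers I u).eq_empty I hj h
    rw [← this, topProd_zero]
  · rintro rfl
    simp [layers_one]

theorem length_cliqueProd {c : Finset A} : I.IsClique (c : Set A) →
    length I (cliqueProd I c) = c.card := by
  induction c using Finset.induction_on with
  | empty => simp
  | insert a c ha ih =>
    intro hc
    rw [cliqueProd_insert I hc ha, length_mul, length_gen, Finset.card_insert_of_notMem ha,
      ih (hc.subset (by simp))]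

/-- A letter depends on itself, so the letter dropped last is the highest `a` of the heap. The
common heap thus reveals the landing row, and erasing `a` there recovers both heaps. -/
theorem eq_of_mul_gen_eq {u v : Trace I} {a : A} (h : u * gen I a = v * gen I a) : u = v := by
  have key : ∀ w : Trace I, a ∈ layers I (w * gen I a) (level I a (layers I w)) ∧
      ∀ j, level I a (layers I w) ≤ j → a ∉ layers I w j := by
    intro w
    constructor
    · rw [layers_mul_gen]
      exact (mem_push I).2 (Or.inr ⟨rfl, rfl⟩)
    · intro j hj ha
      exact (level_mem I (a := a) (layers_eq_empty I w) j hj a ha).ne rfl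
  obtain ⟨hu1, hu2⟩ := key u
  obtain ⟨hv1, hv2⟩ := key v
  rw [h, layers_mul_gen, mem_push] at hu1
  rw [← h, layers_mul_gen, mem_push] at hv1
  have hl : level I a (layers I u) = level I a (layers I v) := by
    rcases hu1 with hu1 | hu1
    · rcases hv1 with hv1 | hv1
      -- Here each landing row would lie strictly below the other.
      · have h1 := mt (hu2 _) (not_not.2 hv1)
        have h2 := mt (hv2 _) (not_not.2 hu1)
        omega
      · exact hv1.2.symm
    · exact hu1.2
  refine layers_injective I ?_
  funext j
  have hj := congrFun (congrArg (layers I) h) j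
  rw [layers_mul_gen, layers_mul_gen, push, push, hl] at hj
  split_ifs at hj with hjl
  · have h1 := hu2 j (by omega)
    have h2 := hv2 j (by omega)
    rw [← Finset.erase_insert h1, hj, Finset.erase_insert h2]
  · exact hj

theorem mul_right_cancel_trace {u v w : Trace I} (h : u * w = v * w) : u = v := by
  induction w using induction_mul_gen with
  | one => simpa using h
  | mul_gen w a ih =>
    rw [← mul_assoc, ← mul_assoc] at h
    exact ih (eq_of_mul_gen_eq I h)

/-- The reversal of traces, as a homomorphism to the opposite monoid. -/
def reverseHom : Trace I →* (Trace I)ᵐᵒᵖ :=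
  PresentedMonoid.lift (fun a => MulOpposite.op (gen I a)) (by
    rintro x y ⟨a, b, h, rfl, rfl⟩
    simp only [map_mul, FreeMonoid.lift_eval_of, ← MulOpposite.op_mul]
    rw [(gen_commute I h).eq])

theorem reverseHom_gen (a : A) : reverseHom I (gen I a) = MulOpposite.op (gen I a) :=
  PresentedMonoid.lift_of _ _

theorem reverseHom_reverseHom (u : Trace I) :
    (reverseHom I (reverseHom I u).unop).unop = u := by
  induction u using induction_mul_gen with
  | one => simp
  | mul_gen u a ih => simp [reverseHom_gen, ih]

/-- Reversal reduces this to right cancellation, where the heap is directly usable. -/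
theorem mul_left_cancel_trace {u v w : Trace I} (h : u * v = u * w) : v = w := by
  have h' := congrArg (fun x => (reverseHom I x).unop) h
  simp only [map_mul, MulOpposite.unop_mul] at h'
  rw [← reverseHom_reverseHom I v, mul_right_cancel_trace I h', reverseHom_reverseHom]

theorem exists_isCartierFoata (u : Trace I) : ∃ l, IsCartierFoata I u l := by
  have hs := isHeap_layers I u
  have hex : ∃ n, layers I u n = ∅ := ⟨_, layers_eq_empty I u _ le_rfl⟩
  have hne : ∀ j, j < Nat.find hex → (layers I u j).Nonempty := fun j hj =>
    Finset.nonempty_iff_ne_empty.2 (Nat.find_min hex hj)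
  refine ⟨List.ofFn fun i : Fin (Nat.find hex) =>
    ⟨layers I u i, hs.clique i, hne i i.2⟩, ?_, ?_⟩
  · rw [List.isChain_iff_getElem]
    intro i hi a ha
    simp only [List.getElem_ofFn] at ha ⊢
    exact hs.supported i a ha
  · have := topProd_layers I u (Nat.find hex) fun j hj => hs.eq_empty I hj (Nat.find_spec hex)
    conv_rhs => rw [← this]
    rw [listTrace, topProd, List.map_ofFn, ← List.map_coe_finRange_eq_range, List.map_map,
      List.ofFn_eq_map]
    congr 1
    refine List.map_congr_left fun j _ => ?_
    simp [cliqueTrace_eq]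

/-- The rows attached to a list of cliques. -/
def listLayers (l : List (NonemptyClique I)) (j : ℕ) : Finset A :=
  (l.map Subtype.val).getD j ∅

theorem listTrace_take (l : List (NonemptyClique I)) (n : ℕ) :
    listTrace I (l.take n) = topProd I (listLayers I l) n := by
  induction n with
  | zero => simp [listTrace]
  | succ n ih =>
    rw [topProd_succ, ← ih, List.take_add_one]
    simp only [listTrace, listLayers, List.map_append, List.prod_append]
    congr 1
    rcases lt_or_ge n l.length with h | h
    · simp [h, cliqueTrace_eq, List.getD]
    · simp [h, List.getD]

theorem isHeap_listLayers {l : List (NonemptyClique I)} (hl : l.IsChain (Admissible I)) :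
    IsHeap I (listLayers I l) := by
  rw [List.isChain_iff_getElem] at hl
  constructor
  · intro j
    rcases lt_or_ge j l.length with h | h
    · simpa [listLayers, h, List.getD] using l[j].2.1
    · simp [listLayers, h, List.getD]
  · intro j a ha
    rcases lt_or_ge (j + 1) l.length with h | h
    · have h' : j < l.length := by omega
      simp only [listLayers, List.getD, List.getElem?_map, h, h', List.getElem?_eq_getElem,
        Option.map_some, Option.getD_some] at ha ⊢
      exact hl j h a ha
    · simp [listLayers, h, List.getD] at ha

/-- An admissible list is the heap of its own product. This is the uniqueness of the decomposition,
which makes the choice by `Classical.epsilon` harmless. -/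
theorem listLayers_cartierFoata (u : Trace I) :
    listLayers I (cartierFoata I u) = layers I u := by
  obtain ⟨hc, hp⟩ := Classical.epsilon_spec (exists_isCartierFoata I u)
  change (cartierFoata I u).IsChain _ at hc
  change listTrace I (cartierFoata I u) = u at hp
  have h := layers_topProd I (isHeap_listLayers I hc) (cartierFoata I u).length
  rw [← listTrace_take, List.take_length, hp] at h
  rw [h]
  funext j
  simp only [trunc]
  split_ifs with hj
  · rfl
  · simp [listLayers, List.getD, not_lt.1 hj]

end Heaps

/-! ### Möbius inversion for the number of traces of each length -/

section Counting

variable {A : Type*} (I : SimpleGraph A)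

theorem ncard_ofLength_dvd [Finite A] (u : Trace I) (n : ℕ) :
    {v | v ∈ ofLength I n ∧ u ∣ v}.ncard =
      if length I u ≤ n then (ofLength I (n - length I u)).ncard else 0 := by
  split_ifs with h
  · rw [← Set.ncard_image_of_injective (ofLength I (n - length I u)) (f := fun v => u * v)
      fun v w hvw => mul_left_cancel_trace I hvw]
    congr 1
    ext v
    simp only [ofLength, Set.mem_ofPred_eq, Set.mem_image]
    constructor
    · rintro ⟨rfl, w, rfl⟩
      exact ⟨w, by simp, rfl⟩
    · rintro ⟨w, hw, rfl⟩
      refine ⟨?_, dvd_mul_right u w⟩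
      rw [length_mul]; omega
  · rw [Set.ncard_eq_zero ((ofLength_finite I n).subset fun v hv => hv.1),
      Set.eq_empty_iff_forall_notMem]
    rintro _ ⟨hv, w, rfl⟩
    simp only [ofLength, Set.mem_ofPred_eq, length_mul] at hv
    omega

theorem length_eq_zero_iff {u : Trace I} : length I u = 0 ↔ u = 1 := by
  constructor
  · intro h
    have := topProd_layers_length I u h.le
    rw [← this, topProd_zero]
  · rintro rfl; simp

/-- The Möbius inversion formula for the numbers of traces of given lengths. -/
theorem sum_cliques_ncard [Fintype A] (n : ℕ) :
    ∑ c ∈ Finset.univ.filter (fun c : Finset A => I.IsClique (c : Set A)),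
      (-1 : ℤ) ^ c.card * (if c.card ≤ n then ((ofLength I (n - c.card)).ncard : ℤ) else 0) =
      if n = 0 then 1 else 0 := by
  set T := (ofLength_finite I n).toFinset with hT
  have h1 : ∀ c ∈ Finset.univ.filter (fun c : Finset A => I.IsClique (c : Set A)),
      (-1 : ℤ) ^ c.card * (if c.card ≤ n then ((ofLength I (n - c.card)).ncard : ℤ) else 0) =
      ∑ v ∈ T, if c ⊆ layers I v 0 then (-1 : ℤ) ^ c.card else 0 := by
    intro c hc
    have hc := (Finset.mem_filter.1 hc).2
    have h := ncard_ofLength_dvd I (cliqueProd I c) n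
    rw [length_cliqueProd I hc] at h
    have h' : ((if c.card ≤ n then ((ofLength I (n - c.card)).ncard : ℤ) else 0)) =
        ((T.filter fun v => c ⊆ layers I v 0).card : ℤ) := by
      rw [← Nat.cast_zero, ← Nat.cast_ite, ← h, ← Set.ncard_coe_finset]
      congr 2
      ext v
      simp [hT, cliqueProd_dvd_iff I hc]
    rw [h', ← Finset.sum_filter, Finset.sum_const, nsmul_eq_mul, mul_comm]
  rw [Finset.sum_congr rfl h1, Finset.sum_comm]
  -- The cliques dividing `v` are all the subsets of its bottom row; their alternating sum vanishes
  -- unless that row is empty, that is, `v = 1`.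
  have h2 : ∀ v ∈ T, ∑ c ∈ Finset.univ.filter (fun c : Finset A => I.IsClique (c : Set A)),
      (if c ⊆ layers I v 0 then (-1 : ℤ) ^ c.card else 0) = if v = 1 then 1 else 0 := by
    intro v _
    have hf : (Finset.univ.filter (fun c : Finset A => I.IsClique (c : Set A))).filter
        (fun c => c ⊆ layers I v 0) = (layers I v 0).powerset := by
      ext c
      simp only [Finset.mem_filter, Finset.mem_univ, true_and, Finset.mem_powerset,
        and_iff_right_iff_imp]
      exact fun h => ((isHeap_layers I v).clique 0).subset (Finset.coe_subset.2 h)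
    rw [← Finset.sum_filter, hf, Finset.sum_powerset_neg_one_pow_card]
    simp only [layers_zero_eq_empty_iff]
  rw [Finset.sum_congr rfl h2, Finset.sum_ite_eq']
  congr 1
  simp only [hT, Set.Finite.mem_toFinset, ofLength, Set.mem_ofPred_eq, length_one, eq_iff_iff]
  exact eq_comm

/-- The generating series of the numbers of traces is the inverse of the Möbius polynomial. -/
theorem mk_ncard_mul_moebius [Fintype A] :
    (PowerSeries.mk fun n => ((ofLength I n).ncard : ℤ)) * (moebius I : PowerSeries ℤ) = 1 := by
  ext n
  rw [PowerSeries.coeff_one, ← sum_cliques_ncard I n, moebius,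
    ← Polynomial.coeToPowerSeries.ringHom_apply, map_sum, Finset.mul_sum, map_sum]
  refine Finset.sum_congr (by congr) fun c _ => ?_
  have : ((-1 : PowerSeries ℤ) ^ c.card) = PowerSeries.C ((-1 : ℤ) ^ c.card) := by simp
  rw [Polynomial.coeToPowerSeries.ringHom_apply, Polynomial.coe_mul, Polynomial.coe_pow,
    Polynomial.coe_pow, Polynomial.coe_neg, Polynomial.coe_one, Polynomial.coe_X, mul_left_comm,
    this, PowerSeries.coeff_C_mul, PowerSeries.coeff_mul_X_pow']
  simp

end Counting

/-! ### Absolutely convergent power series and inverses of polynomials -/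

section Series

/-- The coefficients of `h` are absolutely summable at radius `r`. -/
def SummableAt (h : PowerSeries ℂ) (r : ℝ) : Prop :=
  Summable fun n => ‖PowerSeries.coeff n h‖ * r ^ n

/-- The sum of a power series. -/
noncomputable def seriesEval (h : PowerSeries ℂ) (z : ℂ) : ℂ :=
  ∑' n, PowerSeries.coeff n h * z ^ n

theorem SummableAt.norm_summable {h : PowerSeries ℂ} {r : ℝ} (hh : SummableAt h r) {z : ℂ}
    (hz : ‖z‖ ≤ r) : Summable fun n => ‖PowerSeries.coeff n h * z ^ n‖ := by
  refine Summable.of_nonneg_of_le (fun n => norm_nonneg _) (fun n => ?_) hh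
  rw [norm_mul, norm_pow]
  gcongr

theorem coeff_mul_mul_pow (g h : PowerSeries ℂ) (z : ℂ) (n : ℕ) :
    PowerSeries.coeff n (g * h) * z ^ n = ∑ kl ∈ Finset.HasAntidiagonal.antidiagonal n,
      (PowerSeries.coeff kl.1 g * z ^ kl.1) * (PowerSeries.coeff kl.2 h * z ^ kl.2) := by
  rw [PowerSeries.coeff_mul, Finset.sum_mul]
  refine Finset.sum_congr rfl fun kl hkl => ?_
  rw [← Finset.HasAntidiagonal.mem_antidiagonal.1 hkl, pow_add]
  ring

theorem SummableAt.mul {g h : PowerSeries ℂ} {r : ℝ} (hr : 0 ≤ r) (hg : SummableAt g r)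
    (hh : SummableAt h r) : SummableAt (g * h) r := by
  have hz : ‖(r : ℂ)‖ ≤ r := by simp [abs_of_nonneg hr]
  have := summable_norm_sum_mul_antidiagonal_of_summable_norm (hg.norm_summable hz)
    (hh.norm_summable hz)
  refine this.congr fun n => ?_
  rw [← coeff_mul_mul_pow, norm_mul, norm_pow, Complex.norm_real, Real.norm_of_nonneg hr]

theorem seriesEval_mul {g h : PowerSeries ℂ} {r : ℝ} (hg : SummableAt g r)
    (hh : SummableAt h r) {z : ℂ} (hz : ‖z‖ ≤ r) :
    seriesEval (g * h) z = seriesEval g z * seriesEval h z := by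
  rw [seriesEval, seriesEval, seriesEval, tsum_mul_tsum_eq_tsum_sum_antidiagonal_of_summable_norm
    (hg.norm_summable hz) (hh.norm_summable hz)]
  exact tsum_congr fun n => coeff_mul_mul_pow g h z n

theorem summableAt_polynomial (P : ℂ[X]) (r : ℝ) : SummableAt (P : PowerSeries ℂ) r := by
  refine summable_of_ne_finset_zero (s := Finset.range (P.natDegree + 1)) fun n hn => ?_
  rw [Polynomial.coeff_coe, Polynomial.coeff_eq_zero_of_natDegree_lt (by simpa using hn)]
  simp

theorem seriesEval_polynomial (P : ℂ[X]) (z : ℂ) : seriesEval (P : PowerSeries ℂ) z = P.eval z := by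
  rw [seriesEval, tsum_eq_sum (s := Finset.range (P.natDegree + 1)), Polynomial.eval_eq_sum_range]
  · simp
  · intro n hn
    rw [Polynomial.coeff_coe, Polynomial.coeff_eq_zero_of_natDegree_lt (by simpa using hn)]
    simp

/-- The inverse of a polynomial without roots in a closed disk is absolutely summable there. -/
theorem exists_summableAt_inverse {r : ℝ} (hr : 0 ≤ r) (Q : ℂ[X]) (hQ : Q.coeff 0 = 1)
    (hroot : ∀ z, Q.IsRoot z → r < ‖z‖) :
    ∃ h : PowerSeries ℂ, h * (Q : PowerSeries ℂ) = 1 ∧ SummableAt h r := by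
  induction hn : Q.natDegree generalizing Q with
  | zero =>
    obtain ⟨c, rfl⟩ := Polynomial.natDegree_eq_zero.1 hn
    simp only [coeff_C_zero] at hQ
    subst hQ
    exact ⟨1, by simp, by simpa using summableAt_polynomial 1 r⟩
  | succ n ih =>
    obtain ⟨ρ, hρ⟩ := Complex.exists_root (f := Q)
      (Polynomial.natDegree_pos_iff_degree_pos.1 (by omega))
    have hρr := hroot ρ hρ
    have hρ0 : ρ ≠ 0 := by
      rintro rfl
      simp at hρr
      linarith
    obtain ⟨Q', hQ'⟩ := Polynomial.dvd_iff_isRoot.2 hρ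
    have hQ'0 : Q' ≠ 0 := by
      rintro rfl
      simp [hQ'] at hn
    set R : ℂ[X] := C (-ρ) * Q' with hR
    have hQR : Q = (1 - C ρ⁻¹ * X) * R := by
      rw [hQ', hR]
      have : (C ρ⁻¹ * C ρ : ℂ[X]) = 1 := by rw [← C_mul, inv_mul_cancel₀ hρ0, C_1]
      rw [C_neg]
      linear_combination (- X * Q') * this
    obtain ⟨h, hh, hs⟩ := ih R (by
        have := hQ
        rw [hQR, Polynomial.mul_coeff_zero] at this
        simpa using this) (by
        intro z hz
        refine hroot z ?_
        rw [hQR, Polynomial.IsRoot, Polynomial.eval_mul, hz.eq_zero, mul_zero]) (by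
        have : Q.natDegree = 1 + Q'.natDegree := by
          rw [hQ', Polynomial.natDegree_mul (X_sub_C_ne_zero ρ) hQ'0, natDegree_X_sub_C]
        rw [hR, natDegree_C_mul (neg_ne_zero.2 hρ0)]
        omega)
    have hgs : SummableAt (PowerSeries.mk fun n => ρ⁻¹ ^ n) r := by
      have : r / ‖ρ‖ < 1 := (div_lt_one (norm_pos_iff.2 hρ0)).2 hρr
      refine (summable_geometric_of_lt_one (by positivity) this).congr fun n => ?_
      rw [PowerSeries.coeff_mk, norm_pow, norm_inv, ← mul_pow]
      congr 1
      field_simp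
    refine ⟨h * PowerSeries.mk fun n => ρ⁻¹ ^ n, ?_, hs.mul hr hgs⟩
    have hgeo : (PowerSeries.mk fun n => ρ⁻¹ ^ n) *
        ((1 - C ρ⁻¹ * X : ℂ[X]) : PowerSeries ℂ) = 1 := by
      have : ((1 - C ρ⁻¹ * X : ℂ[X]) : PowerSeries ℂ) =
          1 - PowerSeries.C ρ⁻¹ * PowerSeries.X := by
        simp [Polynomial.coe_sub]
      rw [this]
      ext (_ | n)
      · simp
      · rw [mul_sub, mul_one, mul_left_comm, map_sub, PowerSeries.coeff_C_mul,
          PowerSeries.coeff_succ_mul_X]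
        simp [pow_succ', mul_comm]
    rw [hQR, Polynomial.coe_mul]
    calc _ = (h * (R : PowerSeries ℂ)) * ((PowerSeries.mk fun n => ρ⁻¹ ^ n) *
        ((1 - C ρ⁻¹ * X : ℂ[X]) : PowerSeries ℂ)) := by ring
      _ = 1 := by rw [hh, hgeo, one_mul]

end Series

/-! ### Non-negativity of quotients of Möbius polynomials -/

section Quotients

/-- The coefficients are non-negative, and the constant coefficient is `1`. -/
def NonnegMonic (f : PowerSeries ℤ) : Prop :=
  PowerSeries.coeff 0 f = 1 ∧ ∀ n, 0 ≤ PowerSeries.coeff n f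

theorem NonnegMonic.mul {f g : PowerSeries ℤ} (hf : NonnegMonic f) (hg : NonnegMonic g) :
    NonnegMonic (f * g) := by
  constructor
  · simp only [PowerSeries.coeff_zero_eq_constantCoeff, map_mul] at *
    simp [← PowerSeries.coeff_zero_eq_constantCoeff_apply, hf.1, hg.1]
  · intro n
    rw [PowerSeries.coeff_mul]
    exact Finset.sum_nonneg fun kl _ => mul_nonneg (hf.2 _) (hg.2 _)

/-- The inverse satisfies `g = 1 + X q g`, a recursion for its coefficients without subtraction. -/
theorem exists_nonnegMonic_inverse {q : PowerSeries ℤ} (hq : ∀ n, 0 ≤ PowerSeries.coeff n q) :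
    ∃ g, NonnegMonic g ∧ g * (1 - PowerSeries.X * q) = 1 := by
  refine ⟨PowerSeries.invOfUnit (1 - PowerSeries.X * q) 1, ?_, ?_⟩
  swap
  · rw [mul_comm]
    exact PowerSeries.mul_invOfUnit _ _ (by simp)
  set g := PowerSeries.invOfUnit (1 - PowerSeries.X * q) 1
  have hg : g = 1 + PowerSeries.X * (q * g) := by
    have : (1 - PowerSeries.X * q) * g = 1 := PowerSeries.mul_invOfUnit _ _ (by simp)
    linear_combination this
  have h0 : PowerSeries.coeff 0 g = 1 := by rw [hg]; simp
  refine ⟨h0, fun n => ?_⟩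
  induction n using Nat.strong_induction_on with
  | _ n ih =>
    rcases n with _ | n
    · rw [h0]; exact zero_le_one
    · rw [hg, map_add, PowerSeries.coeff_succ_X_mul, PowerSeries.coeff_mul, PowerSeries.coeff_one,
        if_neg (by omega), zero_add]
      refine Finset.sum_nonneg fun kl hkl => mul_nonneg (hq _) (ih _ ?_)
      have := Finset.HasAntidiagonal.mem_antidiagonal.1 hkl
      omega

variable {A : Type*} (I : SimpleGraph A)

/-- The Möbius polynomial of a set of letters. -/
noncomputable def moebiusOn (V : Finset A) : ℤ[X] :=
  ∑ c ∈ V.powerset.filter (fun c : Finset A => I.IsClique (c : Set A)), (-1) ^ c.card * X ^ c.card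

theorem moebiusOn_univ [Fintype A] : moebiusOn I Finset.univ = moebius I := by
  rw [moebiusOn, moebius, Finset.powerset_univ]

theorem moebiusOn_empty : moebiusOn I ∅ = 1 := by
  have : (∅ : Finset A).powerset.filter (fun c : Finset A => I.IsClique (c : Set A)) = {∅} := by
    ext c
    simp only [Finset.powerset_empty, Finset.mem_filter, Finset.mem_singleton,
      and_iff_left_iff_imp]
    rintro rfl
    simp
  rw [moebiusOn, this]
  simp

/-- The cliques containing `a` are `a` together with a clique of letters independent of `a`. -/
theorem moebiusOn_insert {a : A} {V : Finset A} (ha : a ∉ V) :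
    moebiusOn I (insert a V) = moebiusOn I V - X * moebiusOn I (V.filter (I.Adj a)) := by
  have h1 : ∀ W : Finset A, moebiusOn I W =
      ∑ c ∈ W.powerset, if I.IsClique (c : Set A) then (-1) ^ c.card * X ^ c.card else 0 :=
    fun W => Finset.sum_filter _ _
  rw [h1 (insert a V), Finset.sum_powerset_insert ha, ← h1, sub_eq_add_neg]
  congr 1
  rw [moebiusOn, Finset.mul_sum, ← Finset.sum_neg_distrib, ← Finset.sum_filter]
  refine Finset.sum_congr ?_ fun c hc => ?_
  · ext c
    simp only [Finset.mem_filter, Finset.mem_powerset, Finset.coe_insert]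
    constructor
    · rintro ⟨hc, hcl⟩
      refine ⟨fun b hb => Finset.mem_filter.2 ⟨hc hb, ?_⟩, hcl.subset (by simp)⟩
      exact hcl (by simp) (by simp [hb]) (by rintro rfl; exact ha (hc hb))
    · rintro ⟨hc, hcl⟩
      refine ⟨hc.trans (Finset.filter_subset _ _), ?_⟩
      rw [SimpleGraph.isClique_insert]
      exact ⟨hcl, fun b hb _ => (Finset.mem_filter.1 (hc hb)).2⟩
  · have hac : a ∉ c := fun h => by
      simp only [Finset.mem_filter, Finset.mem_powerset] at hc
      exact ha (Finset.mem_filter.1 (hc.1 h)).1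
    rw [Finset.card_insert_of_notMem hac]
    ring

/-- Remove a letter `a` of `V` outside `W`. By induction `moebiusOn_insert` reads `μ_V = μ_{V∖a} (1
- X q)` with `q` non-negative, so `μ_{V∖a} / μ_V` is non-negative; multiply by `μ_W / μ_{V∖a}`. -/
theorem exists_moebiusOn_quotient (V : Finset A) : ∀ W ⊆ V, ∃ f : PowerSeries ℤ, NonnegMonic f ∧
    f * (moebiusOn I V : PowerSeries ℤ) = (moebiusOn I W : PowerSeries ℤ) := by
  have refl : ∀ W : Finset A, ∃ f : PowerSeries ℤ, NonnegMonic f ∧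
      f * (moebiusOn I W : PowerSeries ℤ) = (moebiusOn I W : PowerSeries ℤ) := fun W =>
    ⟨1, ⟨by simp, fun n => by rw [PowerSeries.coeff_one]; split_ifs <;> simp⟩, one_mul _⟩
  induction V using Finset.strongInduction with
  | H V ih =>
    intro W hW
    rcases hW.eq_or_ssubset with rfl | hWV
    · exact refl W
    obtain ⟨a, haV, haW⟩ := Finset.exists_of_ssubset hWV
    have hlt := Finset.erase_ssubset haV
    obtain ⟨q, hq, hqV⟩ := ih _ hlt ((V.erase a).filter (I.Adj a)) (Finset.filter_subset _ _)
    obtain ⟨g, hg, hgq⟩ := exists_nonnegMonic_inverse hq.2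
    have hgV : g * (moebiusOn I V : PowerSeries ℤ) =
        (moebiusOn I (V.erase a) : PowerSeries ℤ) := by
      conv_lhs => rw [← Finset.insert_erase haV]
      rw [moebiusOn_insert I (Finset.notMem_erase a V), Polynomial.coe_sub, Polynomial.coe_mul,
        Polynomial.coe_X, ← hqV]
      linear_combination (moebiusOn I (V.erase a) : PowerSeries ℤ) * hgq
    obtain ⟨f, hf, hfV⟩ := ih _ hlt W (Finset.subset_erase.2 ⟨hW, haW⟩)
    exact ⟨f * g, hf.mul hg, by rw [mul_assoc, hgV, hfV]⟩

end Quotients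

/-! ### Existence of a positive principal root -/

section PrincipalRoot

/-- A positive root that is the unique complex root of smallest modulus. -/
def IsPositivePrincipalRoot (P : ℤ[X]) (p : ℝ) : Prop :=
  0 < p ∧ aeval (p : ℂ) P = 0 ∧ ∀ z : ℂ, aeval z P = 0 → z ≠ p → p < ‖z‖

/-- The complex power series of an integral power series. -/
noncomputable def toComplex (f : PowerSeries ℤ) : PowerSeries ℂ :=
  PowerSeries.map (Int.castRingHom ℂ) f

theorem toComplex_mul (f g : PowerSeries ℤ) : toComplex (f * g) = toComplex f * toComplex g :=
  map_mul _ _ _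

@[simp] theorem coeff_toComplex (f : PowerSeries ℤ) (n : ℕ) :
    PowerSeries.coeff n (toComplex f) = ((PowerSeries.coeff n f : ℤ) : ℂ) := by
  simp [toComplex]

theorem toComplex_coe (P : ℤ[X]) :
    toComplex (P : PowerSeries ℤ) = (P.map (Int.castRingHom ℂ) : ℂ[X]) := by
  ext n; simp

theorem eval_map_eq_aeval (P : ℤ[X]) (z : ℂ) :
    (P.map (Int.castRingHom ℂ)).eval z = aeval z P := by
  rw [aeval_def, eval₂_eq_eval_map, algebraMap_int_eq]

theorem aeval_ofReal (P : ℤ[X]) (t : ℝ) : aeval (t : ℂ) P = ((aeval t P : ℝ) : ℂ) :=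
  aeval_algebraMap_apply ℂ t P

theorem aeval_pos {P : ℤ[X]} (h0 : P.coeff 0 = 1) {s : ℝ} (hs : 0 ≤ s)
    (h : ∀ t : ℝ, 0 < t → t ≤ s → aeval t P ≠ 0) : 0 < aeval s P := by
  by_contra! hle
  have hcont : ContinuousOn (fun t : ℝ => aeval t P) (Set.Icc 0 s) :=
    (Polynomial.continuous_aeval P).continuousOn
  have h1 : aeval (0 : ℝ) P = 1 := by
    rw [← Polynomial.coeff_zero_eq_aeval_zero', h0]; simp
  obtain ⟨t, ht, ht0⟩ := intermediate_value_Icc' hs hcont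
    (show (0 : ℝ) ∈ Set.Icc _ _ from ⟨hle, by simp only [h1]; norm_num⟩)
  rcases ht.1.eq_or_lt with rfl | htpos
  · simp only [h1] at ht0
    norm_num at ht0
  · exact h t htpos ht.2 ht0

theorem seriesEval_toComplex_ofReal (f : PowerSeries ℤ) (r : ℝ) :
    seriesEval (toComplex f) r = ((∑' n, ((PowerSeries.coeff n f : ℤ) : ℝ) * r ^ n : ℝ) : ℂ) := by
  rw [seriesEval, Complex.ofReal_tsum]
  exact tsum_congr fun n => by simp

theorem NonnegMonic.summableAt_iff {f : PowerSeries ℤ} (hf : NonnegMonic f) {r : ℝ} :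
    SummableAt (toComplex f) r ↔ Summable fun n => ((PowerSeries.coeff n f : ℤ) : ℝ) * r ^ n := by
  have : ∀ n, ‖PowerSeries.coeff n (toComplex f)‖ = ((PowerSeries.coeff n f : ℤ) : ℝ) := fun n => by
    rw [coeff_toComplex, Complex.norm_intCast, abs_of_nonneg]
    exact_mod_cast hf.2 n
  simp only [SummableAt, this]

/-- If `f` has non-negative coefficients and constant coefficient `1`, and if `r f(r) ≤ 1`, then
`z f(z) = 1` holds in the closed disk of radius `r` for `z = r` at most. -/
theorem NonnegMonic.eq_of_mul_seriesEval_eq_one {f : PowerSeries ℤ} (hf : NonnegMonic f) {r : ℝ}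
    (hs : SummableAt (toComplex f) r)
    (hr : r * ∑' n, ((PowerSeries.coeff n f : ℤ) : ℝ) * r ^ n ≤ 1) {z : ℂ} (hz : ‖z‖ ≤ r)
    (h1 : z * seriesEval (toComplex f) z = 1) : z = r := by
  have hr0 : 0 ≤ r := (norm_nonneg z).trans hz
  have hs' := hf.summableAt_iff.1 hs
  have hsz := hs.norm_summable hz
  have e1 : seriesEval (toComplex f) z =
      1 + ∑' n, PowerSeries.coeff (n + 1) (toComplex f) * z ^ (n + 1) := by
    rw [seriesEval, hsz.of_norm.tsum_eq_zero_add]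
    rw [coeff_toComplex, hf.1]
    simp
  have e2 : (∑' n, ((PowerSeries.coeff n f : ℤ) : ℝ) * r ^ n) =
      1 + ∑' n, ((PowerSeries.coeff (n + 1) f : ℤ) : ℝ) * r ^ (n + 1) := by
    rw [hs'.tsum_eq_zero_add, hf.1]
    simp
  have h2 : ‖∑' n, PowerSeries.coeff (n + 1) (toComplex f) * z ^ (n + 1)‖ ≤
      ∑' n, ((PowerSeries.coeff (n + 1) f : ℤ) : ℝ) * r ^ (n + 1) := by
    refine tsum_of_norm_bounded ((summable_nat_add_iff 1).2 hs').hasSum fun n => ?_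
    have h0 : (0 : ℝ) ≤ (PowerSeries.coeff (n + 1) f : ℤ) := by exact_mod_cast hf.2 _
    rw [coeff_toComplex, norm_mul, norm_pow, Complex.norm_intCast, abs_of_nonneg h0]
    gcongr
  set T := ∑' n, PowerSeries.coeff (n + 1) (toComplex f) * z ^ (n + 1)
  set S := ∑' n, ((PowerSeries.coeff (n + 1) f : ℤ) : ℝ) * r ^ (n + 1)
  -- With `f(z) = 1 + T` and `f(r) = 1 + S`, the hypotheses become `1 - z = z T` and `r S ≤ 1 - r`.
  -- The disks `‖z‖ ≤ r` and `‖1 - z‖ ≤ 1 - r` are tangent at `r`.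
  have h3 : ‖1 - z‖ ≤ 1 - r := by
    have : 1 - z = z * T := by rw [e1] at h1; linear_combination -h1
    rw [this, norm_mul]
    rw [e2] at hr
    calc ‖z‖ * ‖T‖ ≤ r * S := by gcongr
      _ ≤ 1 - r := by linarith
  have h4 : 1 - z.re ≤ ‖1 - z‖ := by
    simpa using Complex.re_le_norm (1 - z)
  have h5 := Complex.re_le_norm z
  have h6 : z.re = ‖z‖ := by linarith
  have h7 : ‖z‖ = r := by linarith
  have h8 := Complex.re_eq_norm.1 h6
  apply Complex.ext
  · rw [h6, h7, Complex.ofReal_re]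
  · rw [Complex.ofReal_im, ← (Complex.nonneg_iff.1 h8).2]

variable {P L N : ℤ[X]} {f : PowerSeries ℤ}

theorem summableAt_quotient (hP : P.coeff 0 = 1)
    (hfP : f * (P : PowerSeries ℤ) = (L : PowerSeries ℤ)) {r : ℝ} (hr : 0 ≤ r)
    (h : ∀ z : ℂ, aeval z P = 0 → r < ‖z‖) : SummableAt (toComplex f) r := by
  obtain ⟨g, hg, hgs⟩ := exists_summableAt_inverse hr (P.map (Int.castRingHom ℂ)) (by simp [hP])
    fun z hz => h z (by rw [← eval_map_eq_aeval]; exact hz)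
  have h1 := congrArg toComplex hfP
  rw [toComplex_mul, toComplex_coe, toComplex_coe] at h1
  have h2 : toComplex f = g * (L.map (Int.castRingHom ℂ) : ℂ[X]) := by
    linear_combination g * h1 - toComplex f * hg
  rw [h2]
  exact hgs.mul hr (summableAt_polynomial _ _)

theorem aeval_eq_of_quotient (hfP : f * (P : PowerSeries ℤ) = (L : PowerSeries ℤ))
    (hN : N = P - X * L) {r : ℝ} (hs : SummableAt (toComplex f) r) {z : ℂ} (hz : ‖z‖ ≤ r) :
    aeval z N = aeval z P * (1 - z * seriesEval (toComplex f) z) := by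
  have h1 := congrArg toComplex hfP
  rw [toComplex_mul, toComplex_coe, toComplex_coe] at h1
  have h2 := seriesEval_mul hs (summableAt_polynomial (P.map (Int.castRingHom ℂ)) r) hz
  rw [h1, seriesEval_polynomial, seriesEval_polynomial, eval_map_eq_aeval,
    eval_map_eq_aeval] at h2
  rw [hN, map_sub, map_mul, aeval_X, h2]
  ring

/-- Since `N = P (1 - z f)` on the closed disk, a root of `N` there is either a root of `P`, which
must be `p = r`, or a solution of `z f(z) = 1`, which must be `r`. -/
theorem IsPositivePrincipalRoot.of_le {p : ℝ} (hp : IsPositivePrincipalRoot P p)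
    (hf : NonnegMonic f) (hfP : f * (P : PowerSeries ℤ) = (L : PowerSeries ℤ))
    (hN : N = P - X * L) {r : ℝ} (hr : 0 < r) (hrp : r ≤ p) (hs : SummableAt (toComplex f) r)
    (h1 : r * ∑' n, ((PowerSeries.coeff n f : ℤ) : ℝ) * r ^ n ≤ 1) (h0 : aeval (r : ℂ) N = 0) :
    IsPositivePrincipalRoot N r := by
  refine ⟨hr, h0, fun z hz hzr => ?_⟩
  by_contra! hle
  rw [aeval_eq_of_quotient hfP hN hs hle] at hz
  rcases mul_eq_zero.1 hz with hz | hz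
  · by_cases hzp : z = p
    · have : ‖z‖ = p := by rw [hzp, Complex.norm_real, Real.norm_of_nonneg hp.1.le]
      have : r = p := by linarith
      exact hzr (by rw [hzp, this])
    · have := hp.2.2 z hz hzp
      linarith
  · exact hzr (hf.eq_of_mul_seriesEval_eq_one hs h1 hle (sub_eq_zero.1 hz).symm)

theorem IsPositivePrincipalRoot.exists_sub {p : ℝ} (hp : IsPositivePrincipalRoot P p)
    (hP : P.coeff 0 = 1) (hf : NonnegMonic f)
    (hfP : f * (P : PowerSeries ℤ) = (L : PowerSeries ℤ)) (hN : N = P - X * L) :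
    ∃ q, IsPositivePrincipalRoot N q := by
  have hroot : ∀ r : ℝ, r < p → ∀ z : ℂ, aeval z P = 0 → r < ‖z‖ := by
    intro r hr z hz
    by_cases hzp : z = p
    · rwa [hzp, Complex.norm_real, Real.norm_of_nonneg hp.1.le]
    · exact hr.trans (hp.2.2 z hz hzp)
  have hsum : ∀ r : ℝ, 0 ≤ r → r < p → SummableAt (toComplex f) r := fun r h0 hr =>
    summableAt_quotient hP hfP h0 (hroot r hr)
  have hev : ∀ r : ℝ, 0 ≤ r → SummableAt (toComplex f) r →
      aeval r N = aeval r P * (1 - r * ∑' n, ((PowerSeries.coeff n f : ℤ) : ℝ) * r ^ n) := by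
    intro r h0 hr
    have := aeval_eq_of_quotient hfP hN hr (z := r)
      (by rw [Complex.norm_real, Real.norm_of_nonneg h0])
    rw [seriesEval_toComplex_ofReal, aeval_ofReal, aeval_ofReal] at this
    exact_mod_cast this
  have hPr : ∀ r : ℝ, 0 < r → r < p → aeval r P ≠ 0 := by
    intro r h0 hr h
    have := hroot r hr r (by rw [aeval_ofReal, h, Complex.ofReal_zero])
    rw [Complex.norm_real, Real.norm_of_nonneg h0.le] at this
    exact lt_irrefl _ this
  -- A root `r < p` of `N` satisfies `r f(r) = 1`, as `P(r) ≠ 0`. If there is none, `p` itself is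
  -- the principal root of `N`.
  by_cases hex : ∃ r : ℝ, 0 < r ∧ r < p ∧ aeval r N = 0
  · obtain ⟨r, hr, hrp, hrN⟩ := hex
    have hs := hsum r hr.le hrp
    refine ⟨r, hp.of_le hf hfP hN hr hrp.le hs ?_ (by rw [aeval_ofReal, hrN, Complex.ofReal_zero])⟩
    have := hev r hr.le hs
    rw [hrN, eq_comm, mul_eq_zero] at this
    have := this.resolve_left (hPr r hr hrp)
    linarith
  · push Not at hex
    have hN0 : N.coeff 0 = 1 := by simp [hN, hP]
    have hle : ∀ s : ℝ, 0 ≤ s → s < p →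
        s * ∑' n, ((PowerSeries.coeff n f : ℤ) : ℝ) * s ^ n ≤ 1 := by
      intro s h0 hs
      have h1 := aeval_pos hN0 h0 fun t ht hts => hex t ht (hts.trans_lt hs)
      have h2 := aeval_pos hP h0 fun t ht hts => hPr t ht (hts.trans_lt hs)
      rw [hev s h0 (hsum s h0 hs)] at h1
      have := pos_of_mul_pos_right h1 h2.le
      linarith
    -- Convergence at `p` is not known beforehand. The bound `s f(s) ≤ 1` for `s < p` passes to
    -- partial sums at `p`, and non-negativity then gives summability there; hence `N(p) = P(p) (1 -
    -- p f(p)) = 0`.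
    have hpart : ∀ m, p * ∑ n ∈ Finset.range m, ((PowerSeries.coeff n f : ℤ) : ℝ) * p ^ n ≤ 1 := by
      intro m
      have hcont : Tendsto (fun s : ℝ =>
          s * ∑ n ∈ Finset.range m, ((PowerSeries.coeff n f : ℤ) : ℝ) * s ^ n)
          (𝓝[<] p) (𝓝 (p * ∑ n ∈ Finset.range m, ((PowerSeries.coeff n f : ℤ) : ℝ) * p ^ n)) :=
        (Continuous.tendsto (by fun_prop) p).mono_left nhdsWithin_le_nhds
      refine le_of_tendsto hcont ?_
      filter_upwards [Ioo_mem_nhdsLT hp.1] with s hs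
      refine le_trans ?_ (hle s hs.1.le hs.2)
      have h0 := hs.1.le
      gcongr
      refine Summable.sum_le_tsum _ (fun n _ => ?_) (hf.summableAt_iff.1 (hsum s h0 hs.2))
      have : (0 : ℝ) ≤ (PowerSeries.coeff n f : ℤ) := by exact_mod_cast hf.2 n
      positivity
    have hnn : ∀ n, 0 ≤ ((PowerSeries.coeff n f : ℤ) : ℝ) * p ^ n := fun n => by
      have h1 : (0 : ℝ) ≤ (PowerSeries.coeff n f : ℤ) := by exact_mod_cast hf.2 n
      have h2 := hp.1.le
      positivity
    have hpart' : ∀ m, ∑ n ∈ Finset.range m, ((PowerSeries.coeff n f : ℤ) : ℝ) * p ^ n ≤ 1 / p :=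
      fun m => by
        rw [le_div_iff₀ hp.1, mul_comm]
        exact hpart m
    have hs : SummableAt (toComplex f) p :=
      hf.summableAt_iff.2 (summable_of_sum_range_le hnn hpart')
    refine ⟨p, hp.of_le hf hfP hN hp.1 le_rfl hs ?_ ?_⟩
    · have := Real.tsum_le_of_sum_range_le hnn hpart'
      rwa [le_div_iff₀ hp.1, mul_comm] at this
    · have h := hev p hp.1.le hs
      have hpP := hp.2.1
      rw [aeval_ofReal] at hpP ⊢
      rw [h, Complex.ofReal_mul, hpP, zero_mul]

variable {A : Type*} (I : SimpleGraph A)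

theorem coeff_zero_moebiusOn (V : Finset A) : (moebiusOn I V).coeff 0 = 1 := by
  induction V using Finset.induction_on with
  | empty => simp [moebiusOn_empty]
  | insert a V ha ih => simp [moebiusOn_insert I ha, ih]

theorem exists_isPositivePrincipalRoot (V : Finset A) (hV : V.Nonempty) :
    ∃ p, IsPositivePrincipalRoot (moebiusOn I V) p := by
  induction V using Finset.induction_on with
  | empty => simp at hV
  | insert a V ha ih =>
    rcases V.eq_empty_or_nonempty with rfl | hV'
    · refine ⟨1, one_pos, ?_, fun z hz hz1 => ?_⟩
      · rw [moebiusOn_insert I ha, Finset.filter_empty, moebiusOn_empty]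
        simp
      · refine absurd ?_ hz1
        simp only [moebiusOn_insert I ha, moebiusOn_empty, Finset.filter_empty, mul_one, map_sub,
          map_one, aeval_X] at hz
        rw [Complex.ofReal_one]
        linear_combination -hz
    · obtain ⟨p, hp⟩ := ih hV'
      obtain ⟨f, hf, hfV⟩ := exists_moebiusOn_quotient I V _ (Finset.filter_subset (I.Adj a) V)
      exact hp.exists_sub (coeff_zero_moebiusOn I V) hf hfV (moebiusOn_insert I ha)

end PrincipalRoot

/-! ### Ratio asymptotics of the number of traces -/

section Ratio

theorem tendsto_div_shift {x : ℕ → ℝ} (hx : ∀ k, x k ≠ 0) {q : ℝ}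
    (h : Tendsto (fun k => x k / x (k + 1)) atTop (𝓝 q)) (m : ℕ) :
    Tendsto (fun k => x (k - m) / x k) atTop (𝓝 (q ^ m)) := by
  rw [← tendsto_add_atTop_iff_nat m]
  simp only [Nat.add_sub_cancel]
  induction m with
  | zero => simp [hx]
  | succ m ih =>
    rw [pow_succ]
    refine (ih.mul (h.comp (tendsto_add_atTop_nat m))).congr fun k => ?_
    simp only [Function.comp_apply, ← add_assoc]
    field_simp [hx]

theorem tendsto_choose_div (d : ℕ) :
    Tendsto (fun k => ((d + k).choose d : ℝ) / ((d + (k + 1)).choose d : ℝ)) atTop (𝓝 1) := by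
  have h := tendsto_natCast_div_add_atTop (𝕜 := ℝ) (d : ℝ)
  rw [← tendsto_add_atTop_iff_nat 1] at h
  refine h.congr fun k => ?_
  have h1 := Nat.choose_mul_succ_eq (d + k) d
  rw [show d + k + 1 - d = k + 1 by omega] at h1
  have h2 : ((d + k).choose d : ℝ) * (d + k + 1) = (d + (k + 1)).choose d * (k + 1) := by
    exact_mod_cast h1
  have h3 : ((d + (k + 1)).choose d : ℝ) ≠ 0 := by
    exact_mod_cast (Nat.choose_pos (by omega)).ne'
  have h4 : ((k + 1 : ℕ) : ℝ) + d ≠ 0 := by positivity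
  rw [div_eq_div_iff h4 h3]
  push_cast
  linarith

/-- Tannery's theorem for the product of an absolutely summable series with a binomial series. -/
theorem tendsto_sum_choose {h : ℕ → ℂ} (hh : Summable fun n => ‖h n‖) (d : ℕ) :
    Tendsto (fun k => ∑ j ∈ Finset.range (k + 1),
      h j * (((d + (k - j)).choose d : ℝ) / ((d + k).choose d : ℝ) : ℝ)) atTop
      (𝓝 (∑' j, h j)) := by
  have hpos : ∀ k, (0 : ℝ) < (d + k).choose d := fun k => by
    exact_mod_cast Nat.choose_pos (by omega)
  have key : Tendsto (fun k => ∑' j, if j ≤ k then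
      h j * (((d + (k - j)).choose d : ℝ) / ((d + k).choose d : ℝ) : ℝ) else 0) atTop
      (𝓝 (∑' j, h j)) := by
    refine tendsto_tsum_of_dominated_convergence hh (fun j => ?_) (Eventually.of_forall fun k j => ?_)
    · have h1 := tendsto_div_shift (x := fun k => ((d + k).choose d : ℝ))
        (fun k => (hpos k).ne') (tendsto_choose_div d) j
      rw [one_pow] at h1
      have h2 := ((Complex.continuous_ofReal.tendsto 1).comp h1).const_mul (h j)
      rw [Complex.ofReal_one, mul_one] at h2
      refine h2.congr' ?_
      filter_upwards [eventually_ge_atTop j] with k hk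
      rw [if_pos hk, Function.comp_apply]
    · split_ifs with hjk
      · rw [norm_mul, Complex.norm_real, Real.norm_of_nonneg (by positivity)]
        refine mul_le_of_le_one_right (norm_nonneg _) ?_
        rw [div_le_one (hpos k)]
        exact_mod_cast Nat.choose_le_choose d (by omega)
      · simp
  refine key.congr fun k => ?_
  rw [tsum_eq_sum (s := Finset.range (k + 1))]
  · refine Finset.sum_congr rfl fun j hj => ?_
    rw [if_pos (by simpa [Nat.lt_succ_iff] using hj)]
  · intro j hj
    rw [if_neg (by simpa using hj)]

/-- The series `∑ (d+n choose d) (a X)^n` is the inverse of `(1 - a X)^(d+1)`. -/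
theorem mk_choose_mul_pow (a : ℂ) (d : ℕ) :
    (PowerSeries.mk fun n => ((d + n).choose d : ℂ) * a ^ n) *
      (((1 - C a * X) ^ (d + 1) : ℂ[X]) : PowerSeries ℂ) = 1 := by
  have h : ((PowerSeries.mk 1 : PowerSeries ℂ) * (1 - PowerSeries.X)) ^ (d + 1) = 1 := by
    rw [PowerSeries.mk_one_mul_one_sub_eq_one, one_pow]
  rw [mul_pow, PowerSeries.mk_one_pow_eq_mk_choose_add] at h
  have h := congrArg (PowerSeries.rescale a) h
  rw [map_mul, map_pow, map_sub, map_one, PowerSeries.rescale_X, PowerSeries.rescale_mk] at h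
  rw [← h]
  congr 1
  · ext n; simp [mul_comm]
  · simp [Polynomial.coe_pow, Polynomial.coe_sub]

/-- The root need not be simple: when all letters are independent, the Möbius polynomial is `(1 -
X)^|A|`. -/
theorem exists_factor {Q : ℂ[X]} (hQ : Q.coeff 0 = 1) {p : ℂ} (hp : p ≠ 0) (hroot : Q.IsRoot p) :
    ∃ (d : ℕ) (R : ℂ[X]), Q = (1 - C p⁻¹ * X) ^ (d + 1) * R ∧ ¬ R.IsRoot p ∧ R.coeff 0 = 1 := by
  have hQ0 : Q ≠ 0 := by rintro rfl; simp at hQ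
  obtain ⟨S, hS, hSd⟩ := Polynomial.exists_eq_pow_rootMultiplicity_mul_and_not_dvd Q hQ0 p
  have hm : 0 < Q.rootMultiplicity p := (Polynomial.rootMultiplicity_pos hQ0).2 hroot
  obtain ⟨d, hd⟩ := Nat.exists_eq_succ_of_ne_zero hm.ne'
  rw [hd, Nat.succ_eq_add_one] at hS
  have hlin : (X - C p : ℂ[X]) = C (-p) * (1 - C p⁻¹ * X) := by
    have : (C p * C p⁻¹ : ℂ[X]) = 1 := by rw [← C_mul, mul_inv_cancel₀ hp, C_1]
    rw [C_neg]
    linear_combination (-X) * this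
  refine ⟨d, C (-p) ^ (d + 1) * S, ?_, ?_, ?_⟩
  · conv_lhs => rw [hS, hlin, mul_pow]
    ring
  · rw [Polynomial.dvd_iff_isRoot] at hSd
    simpa [Polynomial.IsRoot, hp] using hSd
  · have := hQ
    rw [hS, hlin, mul_pow, mul_comm (C (-p) ^ (d + 1)), mul_assoc, mul_coeff_zero] at this
    simpa [Polynomial.coeff_zero_eq_eval_zero] using this

/-- The coefficients of the inverse of a polynomial with a positive principal root `p` have
successive quotients converging to `p`. -/
theorem IsPositivePrincipalRoot.tendsto_div {P : ℤ[X]} {p : ℝ} (hp : IsPositivePrincipalRoot P p)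
    (hP : P.coeff 0 = 1) {f : PowerSeries ℤ} (hf : f * (P : PowerSeries ℤ) = 1) :
    Tendsto (fun k => ((PowerSeries.coeff k f : ℤ) : ℝ) / ((PowerSeries.coeff (k + 1) f : ℤ) : ℝ))
      atTop (𝓝 p) := by
  have hp0 : (p : ℂ) ≠ 0 := by exact_mod_cast hp.1.ne'
  obtain ⟨d, R, hR, hRp, hR0⟩ := exists_factor (Q := P.map (Int.castRingHom ℂ)) (by simp [hP]) hp0
    (by rw [Polynomial.IsRoot, eval_map_eq_aeval]; exact hp.2.1)
  obtain ⟨h, hh, hhs⟩ := exists_summableAt_inverse hp.1.le R hR0 (by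
    intro z hz
    refine hp.2.2 z ?_ ?_
    · rw [← eval_map_eq_aeval, hR, eval_mul, hz.eq_zero, mul_zero]
    · rintro rfl; exact hRp hz)
  have hpn : ‖(p : ℂ)‖ ≤ p := by rw [Complex.norm_real, Real.norm_of_nonneg hp.1.le]
  set l := seriesEval h p with hl
  -- Evaluating `h R = 1` at `p` gives `l R(p) = 1`.
  have hl0 : l ≠ 0 := by
    have := seriesEval_mul hhs (summableAt_polynomial R p) hpn
    rw [hh, ← Polynomial.coe_one, seriesEval_polynomial, eval_one] at this
    exact left_ne_zero_of_mul (this ▸ one_ne_zero)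
  have hfG : toComplex f = h * PowerSeries.mk fun n => ((d + n).choose d : ℂ) * (p : ℂ)⁻¹ ^ n := by
    have h1 := congrArg toComplex hf
    rw [toComplex_mul, toComplex_coe, hR, Polynomial.coe_mul, toComplex, toComplex, map_one] at h1
    have h2 := mk_choose_mul_pow (p : ℂ)⁻¹ d
    rw [toComplex]
    generalize (PowerSeries.mk fun n => ((d + n).choose d : ℂ) * (p : ℂ)⁻¹ ^ n) = G at *
    linear_combination (h * G) * h1 - PowerSeries.map (Int.castRingHom ℂ) f * h2
      - PowerSeries.map (Int.castRingHom ℂ) f * G *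
        (((1 - C (p : ℂ)⁻¹ * X) ^ (d + 1) : ℂ[X]) : PowerSeries ℂ) * hh
  set c : ℕ → ℝ := fun k => ((d + k).choose d : ℝ) with hc
  have hc0 : ∀ k, c k ≠ 0 := fun k => by
    simp only [hc]; exact_mod_cast (Nat.choose_pos (by omega)).ne'
  -- The pole at `p` contributes `(d+k choose d) p^(-k)`; after division by it, the convolution with
  -- `h` tends to `h(p)` by Tannery's theorem.
  have hlim : Tendsto (fun k => ((PowerSeries.coeff k f : ℤ) : ℂ) * (p : ℂ) ^ k / (c k : ℂ)) atTop
      (𝓝 l) := by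
    refine (tendsto_sum_choose (hhs.norm_summable hpn) d).congr fun k => ?_
    rw [← coeff_toComplex, hfG, PowerSeries.coeff_mul,
      Finset.Nat.sum_antidiagonal_eq_sum_range_succ_mk, Finset.sum_mul, Finset.sum_div]
    refine Finset.sum_congr rfl fun j hj => ?_
    have hjk : j ≤ k := by simpa [Nat.lt_succ_iff] using hj
    obtain ⟨i, rfl⟩ := Nat.exists_eq_add_of_le hjk
    simp only [hc, PowerSeries.coeff_mk, Nat.add_sub_cancel_left, pow_add]
    have hi : (p : ℂ)⁻¹ ^ i * (p : ℂ) ^ i = 1 := by rw [← mul_pow, inv_mul_cancel₀ hp0, one_pow]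
    push_cast
    linear_combination (-(PowerSeries.coeff j) h * (p : ℂ) ^ j * ((d + i).choose d : ℂ) /
      ((d + (j + i)).choose d : ℂ)) * hi
  have hq : Tendsto (fun k => (((PowerSeries.coeff k f : ℤ) : ℂ) * (p : ℂ) ^ k / (c k : ℂ)) /
      (((PowerSeries.coeff (k + 1) f : ℤ) : ℂ) * (p : ℂ) ^ (k + 1) / (c (k + 1) : ℂ))
      * p * ((c k / c (k + 1) : ℝ) : ℂ)) atTop (𝓝 (l / l * p * ((1 : ℝ) : ℂ))) :=
    ((hlim.div (hlim.comp (tendsto_add_atTop_nat 1)) hl0).mul_const _).mul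
      ((Complex.continuous_ofReal.tendsto 1).comp (tendsto_choose_div d))
  rw [div_self hl0, one_mul, Complex.ofReal_one, mul_one] at hq
  have hre := (Complex.continuous_re.tendsto _).comp hq
  rw [Complex.ofReal_re] at hre
  refine hre.congr fun k => ?_
  have h1 : (c k : ℂ) ≠ 0 := by exact_mod_cast hc0 k
  have h2 : (c (k + 1) : ℂ) ≠ 0 := by exact_mod_cast hc0 (k + 1)
  have : (((PowerSeries.coeff k f : ℤ) : ℂ) * (p : ℂ) ^ k / (c k : ℂ)) /
      (((PowerSeries.coeff (k + 1) f : ℤ) : ℂ) * (p : ℂ) ^ (k + 1) / (c (k + 1) : ℂ))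
      * p * ((c k / c (k + 1) : ℝ) : ℂ) =
      ((((PowerSeries.coeff k f : ℤ) : ℝ) / ((PowerSeries.coeff (k + 1) f : ℤ) : ℝ) : ℝ) : ℂ) := by
    push_cast
    rw [pow_succ]
    field_simp
  rw [Function.comp_apply, this, Complex.ofReal_re]

variable {A : Type*} [Fintype A] [Nonempty A] (I : SimpleGraph A)

theorem tendsto_ncard_ofLength {p : ℝ} (hp : IsPositivePrincipalRoot (moebius I) p) (m : ℕ) :
    Tendsto (fun k => ((ofLength I (k - m)).ncard : ℝ) / ((ofLength I k).ncard : ℝ)) atTop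
      (𝓝 (p ^ m)) := by
  refine tendsto_div_shift (x := fun k => ((ofLength I k).ncard : ℝ)) (fun k => ?_) ?_ m
  · have := (Set.ncard_pos (ofLength_finite I k)).2 (ofLength_nonempty I k)
    exact_mod_cast this.ne'
  · have hP : (moebius I).coeff 0 = 1 := by rw [← moebiusOn_univ, coeff_zero_moebiusOn]
    simpa using hp.tendsto_div hP (mk_ncard_mul_moebius I)

end Ratio

/-! ### The completion as a closed subset of a Cantor space -/

section Topology

variable {A : Type*} (I : SimpleGraph A)

/-- The Cartier-Foata cliques of a finite or infinite trace, followed by empty sets. -/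
noncomputable def coords : Completion I → ℕ → Finset A
  | .fin u => layers I u
  | .inf ξ => fun i => (ξ.1 i).1

theorem isHeap_coords (ζ : Completion I) : IsHeap I (coords I ζ) := by
  cases ζ with
  | fin u => exact isHeap_layers I u
  | inf ξ => exact ⟨fun j => (ξ.1 j).2.1, fun j => ξ.2 j⟩

theorem topping_eq (n : ℕ) (ζ : Completion I) : topping I n ζ = topProd I (coords I ζ) n := by
  cases ζ with
  | fin u => rw [topping, listTrace_take, listLayers_cartierFoata, coords]
  | inf ξ =>
    rw [topping, coords, listTrace, topProd, List.map_ofFn, List.ofFn_eq_map,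
      ← List.map_coe_finRange_eq_range, List.map_map]
    congr 1
    refine List.map_congr_left fun j _ => ?_
    simp [cliqueTrace_eq]

theorem layers_topping (n : ℕ) (ζ : Completion I) :
    layers I (topping I n ζ) = trunc n (coords I ζ) := by
  rw [topping_eq, layers_topProd I (isHeap_coords I ζ)]

theorem coords_injective : Function.Injective (coords I) := by
  have key : ∀ (u : Trace I) (ξ : InfTrace I), coords I (.fin u) ≠ coords I (.inf ξ) := by
    intro u ξ h
    have h1 := congrFun h (length I u)
    rw [coords, coords, layers_eq_empty I u _ le_rfl] at h1
    exact (ξ.1 (length I u)).2.2.ne_empty h1.symm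
  rintro (u | ξ) (v | η) h
  · rw [layers_injective I h]
  · exact absurd h (key u η)
  · exact absurd h.symm (key v ξ)
  · congr 1
    ext i : 2
    exact Subtype.ext (congrFun h i)

/-- An empty row forces all later rows to be empty, so a heap is either finite or has only non-empty
rows. -/
theorem exists_coords_eq {s : ℕ → Finset A} (hs : IsHeap I s) : ∃ ζ, coords I ζ = s := by
  by_cases h : ∃ n, s n = ∅
  · obtain ⟨n, hn⟩ := h
    refine ⟨.fin (topProd I s n), ?_⟩
    rw [coords, layers_topProd I hs]
    funext j
    rw [trunc]
    split_ifs with hj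
    · rfl
    · exact (hs.eq_empty I (not_lt.1 hj) hn).symm
  · push Not at h
    exact ⟨.inf ⟨fun i => ⟨s i, hs.clique i, h i⟩, fun i => hs.supported i⟩, rfl⟩

/-- One topping decides membership: smaller toppings follow by `topProd_layers_dvd`, and from `n` on
`u` is its own topping. -/
theorem mem_cylinder_iff {u : Trace I} {n : ℕ} (hn : length I u ≤ n) {ζ : Completion I} :
    ζ ∈ cylinder I u ↔ u ∣ topping I n ζ := by
  have h1 : topping I n (.fin u) = u := by
    rw [topping_eq]; exact topProd_layers_length I u hn
  constructor
  · intro h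
    have := h n
    rwa [h1] at this
  · intro h m
    rcases le_total m n with hmn | hnm
    · have := topProd_layers_dvd I h m
      have ht : topProd I (trunc n (coords I ζ)) m = topProd I (coords I ζ) m :=
        topProd_congr I fun j hj => if_pos (hj.trans_le hmn)
      rw [layers_topping, ht] at this
      rwa [topping_eq, topping_eq I m ζ]
    · have h2 : topping I m (.fin u) = u := by
        rw [topping_eq]; exact topProd_layers_length I u (hn.trans hnm)
      rw [h2]
      refine h.trans ?_
      rw [topping_eq, topping_eq]
      exact topProd_dvd I _ hnm

theorem fin_mem_cylinder_iff {u v : Trace I} : Completion.fin v ∈ cylinder I u ↔ u ∣ v := by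
  have h := mem_cylinder_iff I (le_max_left (length I u) (length I v)) (ζ := .fin v)
  rwa [topping_eq, coords, topProd_layers_length I v (le_max_right _ _)] at h

/-- The finite and infinite traces with a given topping. -/
def toppingFiber (n : ℕ) (v : Trace I) : Set (Completion I) := {ζ | topping I n ζ = v}

/-- The traces with at most `n` cliques. -/
def heightLE (n : ℕ) : Set (Trace I) := {v | ∀ j, n ≤ j → layers I v j = ∅}

theorem topping_mem_heightLE (n : ℕ) (ζ : Completion I) : topping I n ζ ∈ heightLE I n := by
  intro j hj
  rw [layers_topping, trunc, if_neg (by omega)]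

theorem finite_heightLE [Finite A] (n : ℕ) : (heightLE I n).Finite := by
  refine Set.Finite.of_injOn (f := fun v (i : Fin n) => layers I v i) (t := Set.univ)
    (fun _ _ => trivial) (fun u hu v hv h => ?_) Set.finite_univ
  refine layers_injective I (funext fun j => ?_)
  rcases lt_or_ge j n with hj | hj
  · exact congrFun h ⟨j, hj⟩
  · rw [hu j hj, hv j hj]

/-- The number of cliques replaces the length, because it is what is bounded by `n` for the values
of `topping I n`. -/
theorem mem_cylinder_iff_of_heightLE {n : ℕ} {v : Trace I} (hv : v ∈ heightLE I n)
    {ζ : Completion I} : ζ ∈ cylinder I v ↔ v ∣ topping I n ζ := by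
  have h1 : topping I n (.fin v) = v := by
    rw [topping_eq]; exact topProd_layers I v n hv
  constructor
  · intro h
    have := h n
    rwa [h1] at this
  · intro h
    rw [mem_cylinder_iff I (le_max_left (length I v) n)]
    refine h.trans ?_
    rw [topping_eq, topping_eq]
    exact topProd_dvd I _ (le_max_right _ _)

theorem dvd_antisymm_trace {u v : Trace I} (h : u ∣ v) (h' : v ∣ u) : u = v := by
  obtain ⟨w, rfl⟩ := h
  obtain ⟨x, hx⟩ := h'
  have := congrArg (length I) hx
  simp only [length_mul] at this
  rw [(length_eq_zero_iff I).1 (show length I w = 0 by omega), mul_one]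

/-- A point of the cylinder of `v` whose topping is a proper multiple of `v` lies in the cylinder of
that multiple. With finitely many letters only finitely many cylinders are removed, so the fiber is
clopen. -/
theorem toppingFiber_eq {n : ℕ} {v : Trace I} (hv : v ∈ heightLE I n) :
    toppingFiber I n v = cylinder I v \ ⋃ w ∈ {w ∈ heightLE I n | v ∣ w ∧ w ≠ v}, cylinder I w := by
  ext ζ
  simp only [toppingFiber, Set.mem_ofPred_eq, Set.mem_sdiff, mem_cylinder_iff_of_heightLE I hv,
    Set.mem_iUnion, exists_prop, not_exists, not_and]
  constructor
  · rintro rfl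
    refine ⟨dvd_rfl, ?_⟩
    rintro w ⟨hw, hvw, hne⟩ h
    rw [mem_cylinder_iff_of_heightLE I hw] at h
    exact hne (dvd_antisymm_trace I h hvw)
  · rintro ⟨h, H⟩
    by_contra hne
    refine H _ ⟨topping_mem_heightLE I n ζ, h, hne⟩ ?_
    rw [mem_cylinder_iff_of_heightLE I (topping_mem_heightLE I n ζ)]

theorem cylinder_eq_biUnion {n : ℕ} {v : Trace I} (hv : v ∈ heightLE I n) :
    cylinder I v = ⋃ w ∈ {w ∈ heightLE I n | v ∣ w}, toppingFiber I n w := by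
  ext ζ
  simp only [mem_cylinder_iff_of_heightLE I hv, Set.mem_iUnion, exists_prop, toppingFiber,
    Set.mem_ofPred_eq]
  exact ⟨fun h => ⟨_, ⟨topping_mem_heightLE I n ζ, h⟩, rfl⟩, by rintro ⟨_, ⟨-, h⟩, rfl⟩; exact h⟩

theorem isClopen_cylinder (u : Trace I) : IsClopen (cylinder I u) := by
  constructor
  · rw [← isOpen_compl_iff]
    exact TopologicalSpace.isOpen_generateFrom_of_mem (Or.inr ⟨u, rfl⟩)
  · exact TopologicalSpace.isOpen_generateFrom_of_mem (Or.inl (Or.inr ⟨u, rfl⟩))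

theorem isClopen_toppingFiber [Finite A] (n : ℕ) (v : Trace I) :
    IsClopen (toppingFiber I n v) := by
  by_cases hv : v ∈ heightLE I n
  · rw [toppingFiber_eq I hv]
    refine (isClopen_cylinder I v).diff (Set.Finite.isClopen_biUnion ?_ fun w _ =>
      isClopen_cylinder I w)
    exact (finite_heightLE I n).subset fun w hw => hw.1
  · convert isClopen_empty
    rw [Set.eq_empty_iff_forall_notMem]
    rintro ζ rfl
    exact hv (topping_mem_heightLE I n ζ)

/-- Strictness matters: the row of index `|u|` is then among the first `n` and is empty, which
excludes anything above it. -/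
theorem toppingFiber_singleton {n : ℕ} {u : Trace I} (hn : length I u < n) :
    toppingFiber I n u = {Completion.fin u} := by
  ext ζ
  simp only [toppingFiber, Set.mem_ofPred_eq, Set.mem_singleton_iff]
  constructor
  · intro h
    have hl := layers_topping I n ζ
    rw [h] at hl
    refine coords_injective I (funext fun j => ?_)
    have h0 : coords I ζ (length I u) = ∅ := by
      have := congrFun hl (length I u)
      rw [trunc, if_pos hn, layers_eq_empty I u _ le_rfl] at this
      exact this.symm
    rw [coords, hl, trunc]
    split_ifs with hj
    · rfl
    · exact (isHeap_coords I ζ).eq_empty I (hn.le.trans (not_lt.1 hj)) h0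
  · rintro rfl
    rw [topping_eq]
    exact topProd_layers_length I u hn.le

/-- The embedding of the completion into a Cantor space. -/
noncomputable def code (ζ : Completion I) (i : ℕ) (a : A) : Bool := decide (a ∈ coords I ζ i)

theorem code_injective : Function.Injective (code I) := by
  intro ζ ξ h
  refine coords_injective I (funext fun i => Finset.ext fun a => ?_)
  simpa [code] using congrFun (congrFun h i) a

theorem continuous_code [Finite A] : Continuous (code I) := by
  refine continuous_pi fun i => continuous_pi fun a => ?_
  rw [continuous_discrete_rng]
  intro b
  have : (fun ζ => code I ζ i a) ⁻¹' {b} =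
      ⋃ v ∈ {v | decide (a ∈ layers I v i) = b}, toppingFiber I (i + 1) v := by
    ext ζ
    simp only [Set.mem_preimage, Set.mem_singleton_iff, Set.mem_iUnion, exists_prop, toppingFiber,
      Set.mem_ofPred_eq, exists_eq_right', layers_topping, trunc, lt_add_one, if_true, code]
  rw [this]
  exact isOpen_biUnion fun v _ => (isClopen_toppingFiber I _ v).isOpen

theorem mem_toppingFiber_iff {n : ℕ} {v : Trace I} (hv : v ∈ heightLE I n) {ζ : Completion I} :
    ζ ∈ toppingFiber I n v ↔ ∀ j < n, coords I ζ j = layers I v j := by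
  constructor
  · rintro rfl j hj
    rw [layers_topping, trunc, if_pos hj]
  · intro h
    rw [toppingFiber, Set.mem_ofPred_eq, topping_eq, topProd_congr I h]
    exact topProd_layers I v n hv

theorem mem_heightLE_length (v : Trace I) {n : ℕ} (hn : length I v ≤ n) : v ∈ heightLE I n :=
  fun j hj => layers_eq_empty I v j (hn.trans hj)

/-- Every generating open set is a union of topping fibers, and a fiber is given by finitely many
coordinates of the code. -/
theorem isInducing_code [Finite A] : Topology.IsInducing (code I) := by
  refine ⟨le_antisymm (continuous_code I).le_induced ?_⟩
  set t := TopologicalSpace.induced (code I) inferInstance with ht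
  have hfiber : ∀ n, ∀ v ∈ heightLE I n, IsOpen[t] (toppingFiber I n v) := by
    intro n v hv
    refine isOpen_induced_iff.2
      ⟨⋂ j ∈ Finset.range n, ⋂ a, {x | x j a = decide (a ∈ layers I v j)}, ?_, ?_⟩
    · refine isOpen_biInter_finset fun j _ => isOpen_iInter_of_finite fun a => ?_
      exact (isOpen_discrete {decide (a ∈ layers I v j)}).preimage
        (by fun_prop : Continuous fun x : ℕ → A → Bool => x j a)
    · ext ζ
      simp only [mem_toppingFiber_iff I hv, Set.mem_preimage, Set.mem_iInter, Finset.mem_range,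
        Set.mem_ofPred_eq, code, decide_eq_decide, Finset.ext_iff]
  have hunion : ∀ n, ∀ W ⊆ heightLE I n, IsOpen[t] (⋃ w ∈ W, toppingFiber I n w) :=
    fun n W hW => @isOpen_biUnion _ _ t _ _ fun w hw => hfiber n w (hW hw)
  refine le_generateFrom ?_
  rintro _ ((⟨s, rfl⟩ | ⟨u, rfl⟩) | ⟨u, rfl⟩)
  · have : Completion.fin '' s = ⋃ u ∈ s, toppingFiber I (length I u + 1) u := by
      simp only [toppingFiber_singleton I (Nat.lt_succ_self _)]
      rw [Set.biUnion_eq_iUnion]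
      ext ζ
      simp [eq_comm]
    rw [this]
    exact @isOpen_biUnion _ _ t _ _ fun u _ => hfiber _ u (mem_heightLE_length I u (Nat.le_succ _))
  · rw [cylinder_eq_biUnion I (mem_heightLE_length I u le_rfl)]
    exact hunion _ _ fun w hw => hw.1
  · have : (cylinder I u)ᶜ =
        ⋃ w ∈ {w ∈ heightLE I (length I u) | ¬ u ∣ w}, toppingFiber I (length I u) w := by
      ext ζ
      simp only [Set.mem_compl_iff, mem_cylinder_iff I le_rfl, Set.mem_iUnion, exists_prop,
        toppingFiber, Set.mem_ofPred_eq]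
      exact ⟨fun h => ⟨_, ⟨topping_mem_heightLE I _ ζ, h⟩, rfl⟩,
        by rintro ⟨_, ⟨-, h⟩, rfl⟩; exact h⟩
    rw [this]
    exact hunion _ _ fun w hw => hw.1

/-- The codes are exactly those of heaps, and being a heap constrains only single rows and pairs of
consecutive rows. -/
theorem isClosed_range_code [Fintype A] : IsClosed (Set.range (code I)) := by
  set S : (A → Bool) → Finset A := fun y => Finset.univ.filter fun a => y a = true with hS
  have h : Set.range (code I) = {x | IsHeap I fun j => S (x j)} := by
    ext x
    constructor
    · rintro ⟨ζ, rfl⟩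
      have : (fun j => S (code I ζ j)) = coords I ζ := by
        funext j; ext a; simp [hS, code]
      rw [Set.mem_ofPred_eq, this]
      exact isHeap_coords I ζ
    · intro hx
      obtain ⟨ζ, hζ⟩ := exists_coords_eq I hx
      refine ⟨ζ, ?_⟩
      funext j a
      rw [code, hζ]
      simp [hS]
  have h' : {x : ℕ → A → Bool | IsHeap I fun j => S (x j)} =
      (⋂ j, (fun x : ℕ → A → Bool => x j) ⁻¹' {y | I.IsClique (S y : Set A)}) ∩
      ⋂ j, (fun x : ℕ → A → Bool => (x j, x (j + 1))) ⁻¹'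
        {y | ∀ a ∈ S y.2, ∃ b ∈ S y.1, ¬ I.Adj b a} := by
    ext x
    simp only [Set.mem_ofPred_eq, Set.mem_inter_iff, Set.mem_iInter, Set.mem_preimage]
    exact ⟨fun h => ⟨h.1, h.2⟩, fun h => ⟨h.1, h.2⟩⟩
  rw [h, h']
  exact (isClosed_iInter fun j => (isClosed_discrete _).preimage (by fun_prop)).inter
    (isClosed_iInter fun j => (isClosed_discrete _).preimage (by fun_prop))

theorem isClosedEmbedding_code [Fintype A] : Topology.IsClosedEmbedding (code I) :=
  ⟨⟨isInducing_code I, code_injective I⟩, isClosed_range_code I⟩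

/-- The family of all fibers of toppings, which is a π-system together with the empty set. -/
def toppingFibers : Set (Set (Completion I)) :=
  {s | ∃ n, ∃ v ∈ heightLE I n, s = toppingFiber I n v}

/-- Two fibers are nested or disjoint, since a fiber prescribes an initial segment of rows. -/
theorem isPiSystem_toppingFibers : IsPiSystem (toppingFibers I) := by
  have key : ∀ m n, m ≤ n → ∀ v ∈ heightLE I m, ∀ w ∈ heightLE I n,
      (toppingFiber I m v ∩ toppingFiber I n w).Nonempty →
      toppingFiber I m v ∩ toppingFiber I n w = toppingFiber I n w := by
    rintro m n hmn v hv w hw ⟨ζ, hζv, hζw⟩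
    refine Set.inter_eq_right.2 fun ξ hξ => ?_
    rw [mem_toppingFiber_iff I hv] at hζv ⊢
    rw [mem_toppingFiber_iff I hw] at hζw hξ
    intro j hj
    rw [hξ j (hj.trans_le hmn), ← hζw j (hj.trans_le hmn), hζv j hj]
  rintro _ ⟨m, v, hv, rfl⟩ _ ⟨n, w, hw, rfl⟩ hne
  rcases le_total m n with h | h
  · exact ⟨n, w, hw, key m n h v hv w hw hne⟩
  · rw [Set.inter_comm] at hne ⊢
    exact ⟨m, v, hv, key n m h w hw v hv hne⟩

end Topology

/-! ### Measures determined by cylinders, and weak limits -/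

section Measure

variable {A : Type*} [Fintype A] (I : SimpleGraph A)

instance : CompactSpace (Completion I) := (isClosedEmbedding_code I).compactSpace

instance : T2Space (Completion I) := (isClosedEmbedding_code I).isEmbedding.t2Space

instance : SecondCountableTopology (Completion I) :=
  (isClosedEmbedding_code I).isEmbedding.secondCountableTopology

instance : Countable (Trace I) :=
  (PresentedMonoid.surjective_mk (rels := rel I)).countable

theorem borel_eq_generateFrom_toppingFibers :
    (inferInstance : MeasurableSpace (Completion I)) =
      MeasurableSpace.generateFrom (toppingFibers I) := by
  refine le_antisymm ?_ (MeasurableSpace.generateFrom_le ?_)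
  · change borel (Completion I) ≤ _
    rw [borel_eq_generateFrom_of_subbasis rfl]
    refine MeasurableSpace.generateFrom_le ?_
    have hcyl : ∀ u, MeasurableSet[MeasurableSpace.generateFrom (toppingFibers I)]
        (cylinder I u) := by
      intro u
      rw [cylinder_eq_biUnion I (mem_heightLE_length I u le_rfl)]
      exact MeasurableSet.biUnion (Set.to_countable _) fun w hw =>
        MeasurableSpace.measurableSet_generateFrom ⟨_, w, hw.1, rfl⟩
    rintro _ ((⟨s, rfl⟩ | ⟨u, rfl⟩) | ⟨u, rfl⟩)
    · have : Completion.fin '' s = ⋃ u ∈ s, toppingFiber I (length I u + 1) u := by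
        simp only [toppingFiber_singleton I (Nat.lt_succ_self _)]
        rw [Set.biUnion_eq_iUnion]
        ext ζ
        simp [eq_comm]
      rw [this]
      exact MeasurableSet.biUnion (Set.to_countable _) fun w _ =>
        MeasurableSpace.measurableSet_generateFrom
          ⟨_, w, mem_heightLE_length I w (Nat.le_succ _), rfl⟩
    · exact hcyl u
    · exact (hcyl u).compl
  · rintro _ ⟨n, v, -, rfl⟩
    exact (isClopen_toppingFiber I n v).isOpen.measurableSet

theorem measure_cylinder_eq_sum (ν : Measure (Completion I)) {n : ℕ} {v : Trace I}
    (hv : v ∈ heightLE I n) : ν (cylinder I v) =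
      ∑ w ∈ (finite_heightLE I n).toFinset.filter (v ∣ ·), ν (toppingFiber I n w) := by
  have h : cylinder I v =
      ⋃ w ∈ (finite_heightLE I n).toFinset.filter (v ∣ ·), toppingFiber I n w := by
    rw [cylinder_eq_biUnion I hv]
    congr 1
    ext w
    simp
  rw [h, measure_biUnion_finset]
  · intro w _ x _ hwx
    refine Set.disjoint_left.2 fun ζ hw hx => hwx ?_
    rw [← show topping I n ζ = w from hw, show topping I n ζ = x from hx]
  · exact fun w _ => (isClopen_toppingFiber I n w).isOpen.measurableSet

/-- A probability measure on the completion is determined by its values on cylinders. -/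
theorem eq_of_cylinder_eq {μ ν : ProbabilityMeasure (Completion I)}
    (h : ∀ u, (μ : Measure (Completion I)) (cylinder I u) =
      (ν : Measure (Completion I)) (cylinder I u)) : μ = ν := by
  have key : ∀ n, ∀ v ∈ heightLE I n, (μ : Measure (Completion I)) (toppingFiber I n v) =
      (ν : Measure (Completion I)) (toppingFiber I n v) := by
    intro n
    set F := (finite_heightLE I n).toFinset
    -- Descending induction along divisibility, measured by the number of multiples of `v` in `F`:
    -- the cylinder mass is the mass of the fiber of `v` plus those of the fibers of proper
    -- multiples, which are already known.
    have main : ∀ m, ∀ v ∈ heightLE I n, (F.filter (v ∣ ·)).card ≤ m →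
        (μ : Measure (Completion I)) (toppingFiber I n v) =
          (ν : Measure (Completion I)) (toppingFiber I n v) := by
      intro m
      induction m with
      | zero =>
        intro v hv hc
        have : v ∈ F.filter (v ∣ ·) := by simp [F, hv]
        rw [Nat.le_zero, Finset.card_eq_zero] at hc
        simp [hc] at this
      | succ m ih =>
        intro v hv hc
        have hvF : v ∈ F.filter (v ∣ ·) := by simp [F, hv]
        have hu := h v
        rw [measure_cylinder_eq_sum I _ hv, measure_cylinder_eq_sum I _ hv,
          ← Finset.add_sum_erase _ _ hvF, ← Finset.add_sum_erase _ _ hvF] at hu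
        have hsum : ∀ w ∈ (F.filter (v ∣ ·)).erase v,
            (μ : Measure (Completion I)) (toppingFiber I n w) =
              (ν : Measure (Completion I)) (toppingFiber I n w) := by
          intro w hw
          have hwv := Finset.ne_of_mem_erase hw
          have hw' := Finset.mem_filter.1 (Finset.mem_of_mem_erase hw)
          refine ih w (by simpa [F] using hw'.1) ?_
          have : (F.filter (w ∣ ·)).card < (F.filter (v ∣ ·)).card := by
            refine Finset.card_lt_card ⟨fun x hx => ?_, fun hsub => ?_⟩
            · rw [Finset.mem_filter] at hx ⊢
              exact ⟨hx.1, hw'.2.trans hx.2⟩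
            · exact hwv (dvd_antisymm_trace I (Finset.mem_filter.1 (hsub hvF)).2 hw'.2)
          omega
        rw [Finset.sum_congr rfl hsum] at hu
        exact (ENNReal.add_left_inj (by simp [ENNReal.sum_eq_top])).1 hu
    exact fun v hv => main _ v hv le_rfl
  apply Subtype.ext
  change (μ : Measure (Completion I)) = (ν : Measure (Completion I))
  refine ext_of_generate_finite (toppingFibers I) (borel_eq_generateFrom_toppingFibers I)
    (isPiSystem_toppingFibers I) ?_ (by simp)
  rintro _ ⟨n, v, hv, rfl⟩
  exact key n v hv

theorem IsSubUniform.eq {p : ℝ} {μ ν : ProbabilityMeasure (Completion I)}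
    (hμ : IsSubUniform I p μ) (hν : IsSubUniform I p ν) : μ = ν := by
  refine eq_of_cylinder_eq I fun u => ?_
  have : μ (cylinder I u) = ν (cylinder I u) := NNReal.coe_injective ((hμ u).trans (hν u).symm)
  simpa [← ProbabilityMeasure.ennreal_coeFn_eq_coeFn_toMeasure] using this

variable [Nonempty A]

theorem uniformOfLength_apply (k : ℕ) {s : Set (Completion I)} (hs : MeasurableSet s) :
    (uniformOfLength I k s : ℝ) =
      ({u | u ∈ ofLength I k ∧ Completion.fin u ∈ s}.ncard : ℝ) / (ofLength I k).ncard := by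
  have hf : Measurable (Completion.fin : Trace I → Completion I) := Measurable.of_discrete
  have h : (uniformOfLength I k : Measure (Completion I)) s =
      ProbabilityTheory.uniformOn (ofLength I k) (Completion.fin ⁻¹' s) :=
    Measure.map_apply hf hs
  have hfin := ofLength_finite I k
  have hfin' : (ofLength I k ∩ Completion.fin ⁻¹' s).Finite := hfin.inter_of_left _
  change ((uniformOfLength I k : Measure (Completion I)) s).toReal = _
  rw [h, ProbabilityTheory.uniformOn, ProbabilityTheory.cond_apply MeasurableSet.of_discrete,
    Measure.count_apply_finite _ hfin, Measure.count_apply_finite _ hfin',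
    ← Set.ncard_eq_toFinset_card _ hfin, ← Set.ncard_eq_toFinset_card _ hfin', ENNReal.toReal_mul,
    ENNReal.toReal_inv, ENNReal.toReal_natCast, ENNReal.toReal_natCast, div_eq_inv_mul]
  rfl

theorem tendsto_uniformOfLength_cylinder {p : ℝ} (hp : IsPositivePrincipalRoot (moebius I) p)
    (u : Trace I) : Tendsto (fun k => (uniformOfLength I k (cylinder I u) : ℝ)) atTop
      (𝓝 (p ^ length I u)) := by
  refine (tendsto_ncard_ofLength I hp (length I u)).congr' ?_
  filter_upwards [eventually_ge_atTop (length I u)] with k hk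
  rw [uniformOfLength_apply I k (isClopen_cylinder I u).isOpen.measurableSet]
  simp only [fin_mem_cylinder_iff]
  rw [ncard_ofLength_dvd, if_pos hk]

theorem tendsto_uniformOfLength_singleton (u : Trace I) :
    Tendsto (fun k => (uniformOfLength I k {Completion.fin u} : ℝ)) atTop (𝓝 0) := by
  refine tendsto_const_nhds.congr' ?_
  filter_upwards [eventually_gt_atTop (length I u)] with k hk
  rw [← toppingFiber_singleton I (Nat.lt_succ_self _),
    uniformOfLength_apply I k (isClopen_toppingFiber I _ u).isOpen.measurableSet,
    toppingFiber_singleton I (Nat.lt_succ_self _)]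
  have : {v | v ∈ ofLength I k ∧ Completion.fin v ∈ ({Completion.fin u} : Set (Completion I))} =
      ∅ := by
    rw [Set.eq_empty_iff_forall_notMem]
    rintro v ⟨hv, hvu⟩
    simp only [Set.mem_singleton_iff, Completion.fin.injEq] at hvu
    subst hvu
    exact hk.ne hv
  rw [this]
  simp

theorem tendsto_apply_of_isClopen {𝒰 : Filter ℕ} {ν : ProbabilityMeasure (Completion I)}
    (h : Tendsto (fun k => uniformOfLength I k) 𝒰 (𝓝 ν)) {s : Set (Completion I)}
    (hs : IsClopen s) : Tendsto (fun k => (uniformOfLength I k s : ℝ)) 𝒰 (𝓝 (ν s : ℝ)) :=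
  (NNReal.continuous_coe.tendsto _).comp
    (ProbabilityMeasure.tendsto_measure_of_isClopen_of_tendsto h hs)

theorem isSubUniform_of_tendsto {p : ℝ} (hp : IsPositivePrincipalRoot (moebius I) p)
    {𝒰 : Filter ℕ} [𝒰.NeBot] (h𝒰 : 𝒰 ≤ atTop) {ν : ProbabilityMeasure (Completion I)}
    (h : Tendsto (fun k => uniformOfLength I k) 𝒰 (𝓝 ν)) : IsSubUniform I p ν := fun u =>
  tendsto_nhds_unique (tendsto_apply_of_isClopen I h (isClopen_cylinder I u))
    ((tendsto_uniformOfLength_cylinder I hp u).mono_left h𝒰)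

/-- Each finite trace is a clopen point whose mass is zero once `k > |u|`, hence zero in the limit;
there are only countably many of them. -/
theorem boundary_eq_one_of_tendsto {𝒰 : Filter ℕ} [𝒰.NeBot] (h𝒰 : 𝒰 ≤ atTop)
    {ν : ProbabilityMeasure (Completion I)}
    (h : Tendsto (fun k => uniformOfLength I k) 𝒰 (𝓝 ν)) : ν (boundary I) = 1 := by
  have h0 : ∀ u, (ν : Measure (Completion I)) {Completion.fin u} = 0 := by
    intro u
    have hcl : IsClopen ({Completion.fin u} : Set (Completion I)) := by
      rw [← toppingFiber_singleton I (Nat.lt_succ_self _)]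
      exact isClopen_toppingFiber I _ u
    have := tendsto_nhds_unique (tendsto_apply_of_isClopen I h hcl)
      ((tendsto_uniformOfLength_singleton I u).mono_left h𝒰)
    rw [← ProbabilityMeasure.ennreal_coeFn_eq_coeFn_toMeasure]
    simpa using this
  have hb : (boundary I)ᶜ = ⋃ u : Trace I, {Completion.fin u} := by
    ext (u | ξ) <;> simp [boundary]
  have hm : MeasurableSet (boundary I) := by
    rw [← MeasurableSet.compl_iff, hb]
    exact MeasurableSet.iUnion fun u => measurableSet_singleton _
  have hz : (ν : Measure (Completion I)) (boundary I)ᶜ = 0 := by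
    rw [hb, measure_iUnion_null_iff]
    exact h0
  have h1 := (prob_compl_eq_zero_iff (μ := (ν : Measure (Completion I))) hm).1 hz
  rw [← ProbabilityMeasure.ennreal_coeFn_eq_coeFn_toMeasure] at h1
  exact_mod_cast h1

end Measure

end TraceMonoid

theorem theorem4 {A : Type*} [Fintype A] [Nonempty A] (I : SimpleGraph A) :
    ∃ p₀ : ℝ, 0 < p₀ ∧ TraceMonoid.IsPrincipalRoot I (p₀ : ℂ) ∧
      ∃ ν : ProbabilityMeasure (TraceMonoid.Completion I),
        TraceMonoid.IsSubUniform I p₀ ν ∧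
        (∀ ν' : ProbabilityMeasure (TraceMonoid.Completion I),
          TraceMonoid.IsSubUniform I p₀ ν' → ν' = ν) ∧
        ν (TraceMonoid.boundary I) = 1 ∧
        Tendsto (fun k : ℕ => TraceMonoid.uniformOfLength I k) atTop (𝓝 ν) := by
  obtain ⟨p, hp⟩ := TraceMonoid.exists_isPositivePrincipalRoot I Finset.univ Finset.univ_nonempty
  rw [TraceMonoid.moebiusOn_univ] at hp
  -- Compactness of the space of probability measures gives a limit along every ultrafilter.
  have hlim : ∀ 𝒰 : Ultrafilter ℕ, ∃ ν, Tendsto (fun k => TraceMonoid.uniformOfLength I k) 𝒰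
      (𝓝 ν) := fun 𝒰 => by
    obtain ⟨ν, -, hν⟩ := isCompact_univ.ultrafilter_le_nhds
      (𝒰.map fun k => TraceMonoid.uniformOfLength I k) (by simp)
    exact ⟨ν, hν⟩
  obtain ⟨ν, hν⟩ := hlim (Ultrafilter.of atTop)
  have hsub := TraceMonoid.isSubUniform_of_tendsto I hp (Ultrafilter.of_le atTop) hν
  refine ⟨p, hp.1, ⟨hp.2.1, fun z hz hzp => ?_⟩, ν, hsub, fun ν' h => h.eq I hsub,
    TraceMonoid.boundary_eq_one_of_tendsto I (Ultrafilter.of_le atTop) hν, ?_⟩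
  · rw [Complex.norm_real, Real.norm_of_nonneg hp.1.le]
    exact hp.2.2 z hz hzp
  -- The limit along any ultrafilter finer than `atTop` has the same cylinder masses, hence equals
  -- `ν`; this is convergence.
  · rw [tendsto_iff_ultrafilter]
    intro 𝒰 h𝒰
    obtain ⟨ν', hν'⟩ := hlim 𝒰
    rwa [(TraceMonoid.isSubUniform_of_tendsto I hp h𝒰 hν').eq I hsub] at hν'
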